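/- Let $s\ge 0$ and let $\mathbf B_0,\dots,\mathbf B_s$ be quaternion algebras over $\mathbb Q$ (possibly split). Let $\mathbf G_i=\mathbf B_i^\times/\mathbb G_m$ be their projective groups of units, $\mathbf G=\prod_i\mathbf G_i$, and let $\mathbf G(\mathbb A)^+\subset\mathbf G(\mathbb A)$ be the image of the tuples of adelic quaternions of reduced norm $1$, where $\mathbb A$ is the adele ring of $\mathbb Q$. Put $\mathbf G_{\mathrm{char}}=\mathbf G(\mathbb Q)\backslash\mathbf G(\mathbb A)/\mathbf G(\mathbb A)^+$. Let $(\chi_i)_{0\le i\le s}$ be a tuple of quadratic Hecke characters of $\mathbb Q$, i.e. continuous characters $\chi_i:\mathbb Q^\times\backslash\mathbb A^\times/(\mathbb A^\times)^2\to\{\pm1\}$, and let $\chi$ be the associated character of $\mathbf G_{\mathrm{char}}$, $$\chi\big((g_i)_i\big)=\prod_{i=0}^s\chi_i(\mathrm{Nr}_i(g_i)),$$ where $\mathrm{Nr}_i$ is the reduced norm of $\mathbf B_i$. For a quadratic field $\mathbf K$ and a tuple $\iota=(\iota_i)_i$ of embeddings $\iota_i:\mathbf K\to\mathbf B_i$,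 let $\mathbf T_\iota=\{(\iota_0(t),\dots,\iota_s(t)): t\in \mathrm{Res}_{\mathbf K/\mathbb Q}(\mathbb G_m)/\mathbb G_m\}\subset\mathbf G$ be the associated diagonally embedded torus, $[\mathbf T_\iota]=\mathbf T_\iota(\mathbb Q)\backslash\mathbf T_\iota(\mathbb A)$, and let $dt$ be the Haar probability measure on the compact group $[\mathbf T_\iota]$. Let $\Pi=\prod_i\chi_i$. 1. If $\Pi=1$, then for every quadratic field $\mathbf K$ and every torus $\mathbf T_\iota$ as above, $\int_{[\mathbf T_\iota]}\chi(t)\,dt=1$. 2. If $\Pi\ne1$, then there is a unique squarefree integer $d\neq 1$ such that $\Pi$ corresponds to the Legendre symbol $\left(\frac{d}{\cdot}\right)$, i.e. such that for every odd prime $p\nmid d$ the character $\Pi$ is unramified at $p$ and takes the value $\left(\frac dp\right)$ on the idele equal to $p$ at the place $p$ and to $1$ at all other places. Put $\mathbf K_\Pi=\mathbb Q(\sqrt d)$. For every quadratic field $\mathbf K$ and every torus $\mathbf T_\iota$ with associated field $\mathbf K$, $$\int_{[\mathbf T_\iota]}\chi(t)\,dt=\begin{cases}1&\text{if }\mathbf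 K\cong\mathbf K_\Pi,\\0&\text{otherwise.}\end{cases}$$ -/

import Mathlib

open MeasureTheory
open scoped Quaternion TensorProduct

noncomputable section

namespace TorusCharacter

/-! ### Adeles, ideles and quadratic Hecke characters of `ℚ` -/

/-- The adele ring `𝔸` of `ℚ`. -/
abbrev Adeles : Type := NumberField.AdeleRing ℤ ℚ

/-- The diagonal embedding `ℚˣ → 𝔸ˣ`. -/
def principalIdele : ℚˣ →* Adelesˣ := Units.map (algebraMap ℚ Adeles).toMonoidHom

/-- The group of quadratic Hecke characters of `ℚ`: continuous homomorphisms `𝔸ˣ → {±1}` that are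
trivial on `ℚˣ`. (Having values in `{±1}` they are trivial on squares of ideles.) -/
def quadraticHeckeCharacters : Subgroup (Adelesˣ →ₜ* ℤˣ) where
  carrier := {ψ | ∀ q : ℚˣ, ψ (principalIdele q) = 1}
  one_mem' := fun _ => rfl
  mul_mem' := fun {ψ φ} hψ hφ q => by
    change ψ (principalIdele q) * φ (principalIdele q) = 1
    rw [hψ q, hφ q, one_mul]
  inv_mem' := fun {ψ} hψ q => by
    change (ψ (principalIdele q))⁻¹ = 1
    rw [hψ q, inv_one]

/-- The finite place of `ℚ` attached to a prime number `p`. -/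
def placeOfPrime (p : ℕ) [hp : Fact p.Prime] : IsDedekindDomain.HeightOneSpectrum ℤ where
  asIdeal := Ideal.span {(p : ℤ)}
  isPrime := (Ideal.span_singleton_prime (Nat.cast_ne_zero.mpr hp.out.ne_zero)).mpr
    (Nat.prime_iff_prime_int.mp hp.out)
  ne_bot := fun h => hp.out.ne_zero
    (Nat.cast_eq_zero.mp (Ideal.span_singleton_eq_bot.mp h))

open Classical in
/-- The inclusion `ℚ_vˣ → 𝔸ˣ` at a finite place `v` (all other components are `1`). -/
def localIdele (v : IsDedekindDomain.HeightOneSpectrum ℤ) (x : (v.adicCompletion ℚ)ˣ) : Adelesˣ :=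
  MulEquiv.prodUnits.symm
    ((1 : (NumberField.InfiniteAdeleRing ℚ)ˣ),
      ((RestrictedProduct.unitsEquiv (fun w : IsDedekindDomain.HeightOneSpectrum ℤ =>
        w.adicCompletion ℚ)).symm (RestrictedProduct.mulSingle _ v x) :
          (IsDedekindDomain.FiniteAdeleRing ℤ ℚ)ˣ))

/-- The prime `p`, as an element of `ℚ_pˣ`. -/
def primeUniformizer (p : ℕ) [hp : Fact p.Prime] : ((placeOfPrime p).adicCompletion ℚ)ˣ :=
  Units.map (algebraMap ℚ ((placeOfPrime p).adicCompletion ℚ)).toMonoidHom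
    (Units.mk0 (p : ℚ) (Nat.cast_ne_zero.mpr hp.out.ne_zero))

/-- The Hecke character `ψ` corresponds to the Legendre symbol `(d / ·)` of the quadratic field
`ℚ(√d)`, where `d ≠ 1` is a squarefree integer: at every odd prime `p ∤ d`, `ψ` is unramified and
takes the value `(d / p)` on the idele which is `p` at the place `p` and `1` elsewhere. -/
def CorrespondsToLegendreSymbol (ψ : Adelesˣ →ₜ* ℤˣ) (d : ℤ) : Prop :=
  Squarefree d ∧ d ≠ 1 ∧
    ∀ (p : ℕ) [Fact p.Prime], p ≠ 2 → ¬ (p : ℤ) ∣ d →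
      (∀ u : ((placeOfPrime p).adicCompletion ℚ)ˣ,
        Valued.v (u : (placeOfPrime p).adicCompletion ℚ) = 1 →
          ψ (localIdele (placeOfPrime p) u) = 1) ∧
      ((ψ (localIdele (placeOfPrime p) (primeUniformizer p)) : ℤˣ) : ℤ) = legendreSym p d

/-! ### Projective unit groups -/

/-- The image of `Rˣ` in the unit group of an `R`-algebra `A`. -/
def scalarUnits (R A : Type*) [CommRing R] [Ring A] [Algebra R A] : Subgroup Aˣ :=
  (Units.map (algebraMap R A).toMonoidHom).range

instance scalarUnits_normal (R A : Type*) [CommRing R] [Ring A] [Algebra R A] :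
    (scalarUnits R A).Normal where
  conj_mem := by
    rintro _ ⟨r, rfl⟩ g
    refine ⟨r, ?_⟩
    rw [eq_mul_inv_iff_mul_eq]
    ext
    exact Algebra.commutes (r : R) (g : A)

/-- The projective unit group `Aˣ / Rˣ` of an `R`-algebra `A`. -/
abbrev ProjUnits (R A : Type*) [CommRing R] [Ring A] [Algebra R A] : Type _ :=
  Aˣ ⧸ scalarUnits R A

/-- Functoriality of `Aˣ / Rˣ` in the `R`-algebra `A`. -/
def ProjUnits.map {R A B : Type*} [CommRing R] [Ring A] [Algebra R A] [Ring B] [Algebra R B]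
    (f : A →ₐ[R] B) : ProjUnits R A →* ProjUnits R B :=
  QuotientGroup.map _ _ (Units.map (f : A →* B)) (by
    rintro _ ⟨r, rfl⟩
    refine ⟨r, ?_⟩
    ext
    exact (f.commutes (r : R)).symm)

/-! ### Quaternion algebras `B = (a, b / ℚ)`, with `i² = a`, `j² = b`, `ij = -ji` -/

/-- The reduced norm of the quaternion algebra `(a, b / R)`. -/
def redNorm {R : Type*} [CommRing R] (a b : R) : ℍ[R,a,b] →* R where
  toFun x := x.re ^ 2 - a * x.imI ^ 2 - b * x.imJ ^ 2 + a * b * x.imK ^ 2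
  map_one' := by simp
  map_mul' x y := by simp; ring

/-- The ring `B(𝔸)` of adelic points of the quaternion algebra `B = (a, b / ℚ)`. -/
abbrev AdelicQuaternion (a b : ℚ) : Type :=
  ℍ[Adeles, algebraMap ℚ Adeles a, algebraMap ℚ Adeles b]

/-- The topology of `B(𝔸)`, that is, the product topology of `𝔸⁴` in the basis `1, i, j, k`. -/
instance (a b : ℚ) : TopologicalSpace (AdelicQuaternion a b) :=
  TopologicalSpace.induced (QuaternionAlgebra.equivTuple _ _ _) inferInstance

/-- The natural map `B(ℚ) → B(𝔸)`. -/
def rationalToAdelic (a b : ℚ) : ℍ[ℚ,a,b] →ₐ[ℚ] AdelicQuaternion a b where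
  toFun x := ⟨algebraMap ℚ Adeles x.re, algebraMap ℚ Adeles x.imI,
    algebraMap ℚ Adeles x.imJ, algebraMap ℚ Adeles x.imK⟩
  map_one' := by ext <;> simp
  map_zero' := by ext <;> simp
  map_mul' x y := by ext <;> simp
  map_add' x y := by ext <;> simp
  commutes' q := by
    rw [QuaternionAlgebra.algebraMap_eq]
    ext <;> rw [map_zero] <;> rfl

/-- The group `G(𝔸) = B(𝔸)ˣ / 𝔸ˣ` of adelic points of the projective unit group `G` of `B`,
with its quotient topology. -/
abbrev AdelicPB (a b : ℚ) : Type := ProjUnits Adeles (AdelicQuaternion a b)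

/-- The reduced norm `B(𝔸)ˣ → 𝔸ˣ`. -/
def ideleNorm (a b : ℚ) : (AdelicQuaternion a b)ˣ →* Adelesˣ :=
  Units.map (redNorm (algebraMap ℚ Adeles a) (algebraMap ℚ Adeles b))

/-- The image `G(ℚ)` of `B(ℚ)ˣ` in `G(𝔸)`. -/
def rationalPB (a b : ℚ) : Subgroup (AdelicPB a b) :=
  ((QuotientGroup.mk' _).comp
    (Units.map (rationalToAdelic a b : ℍ[ℚ,a,b] →* AdelicQuaternion a b))).range

/-- The subgroup `G(𝔸)⁺` of `G(𝔸)`: the image of the elements of `B(𝔸)` of reduced norm `1`. -/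
def plusPB (a b : ℚ) : Subgroup (AdelicPB a b) :=
  (ideleNorm a b).ker.map (QuotientGroup.mk' _)

/-- The homomorphism `g ↦ ψ(Nr(g))` on `G(𝔸)`, for a character `ψ : 𝔸ˣ → {±1}`. -/
def compNorm (a b : ℚ) (ψ : Adelesˣ →ₜ* ℤˣ) : AdelicPB a b →* ℤˣ :=
  QuotientGroup.lift _ ((ψ : Adelesˣ →* ℤˣ).comp (ideleNorm a b)) (by
    rintro _ ⟨r, rfl⟩
    have h : ideleNorm a b (Units.map (algebraMap Adeles (AdelicQuaternion a b)).toMonoidHom r)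
        = r * r := by
      ext
      simp [ideleNorm, redNorm, QuaternionAlgebra.algebraMap_eq, sq]
    change ψ (ideleNorm a b _) = 1
    rw [h, map_mul, Int.units_mul_self])

/-! ### The product group and its group `G_char` -/

variable {s : ℕ}

/-- The group `G(𝔸) = ∏ᵢ Gᵢ(𝔸)`. -/
abbrev AdelicG (a b : Fin (s + 1) → ℚ) : Type := ∀ i, AdelicPB (a i) (b i)

/-- The subgroup `G(ℚ) G(𝔸)⁺` of `G(𝔸)`. -/
def rationalPlus (a b : Fin (s + 1) → ℚ) : Subgroup (AdelicG a b) :=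
  Subgroup.pi Set.univ (fun i => rationalPB (a i) (b i)) ⊔
    Subgroup.pi Set.univ (fun i => plusPB (a i) (b i))

instance rationalPlus_normal (a b : Fin (s + 1) → ℚ) : (rationalPlus a b).Normal := by
  apply Subgroup.Normal.of_commutator_le
  refine le_trans ?_ le_sup_right
  rw [commutator_def, Subgroup.commutator_le]
  intro g _ h _ i _
  induction hg : g i using QuotientGroup.induction_on with
  | H x =>
    induction hh : h i using QuotientGroup.induction_on with
    | H y =>
      refine ⟨x * y * x⁻¹ * y⁻¹, ?_, ?_⟩
      · rw [SetLike.mem_coe, MonoidHom.mem_ker, map_mul, map_mul, map_mul, map_inv, map_inv,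
          mul_comm (ideleNorm _ _ x), mul_inv_cancel_right, mul_inv_cancel]
      · change _ = g i * h i * (g i)⁻¹ * (h i)⁻¹
        rw [hg, hh]
        rfl

/-- `G_char = G(ℚ) \ G(𝔸) / G(𝔸)⁺`; as `G(𝔸)⁺` is normal in `G(𝔸)` and contains all commutators,
this is the quotient group of `G(𝔸)` by `G(ℚ) G(𝔸)⁺`. -/
abbrev GChar (a b : Fin (s + 1) → ℚ) : Type := AdelicG a b ⧸ rationalPlus a b

/-- The homomorphism `g ↦ ∏ᵢ χᵢ(Nrᵢ(gᵢ))` on `G(𝔸)`. -/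
def prodCompNorm (a b : Fin (s + 1) → ℚ) (χ : Fin (s + 1) → quadraticHeckeCharacters) :
    AdelicG a b →* ℤˣ :=
  ∏ i, (compNorm (a i) (b i) (χ i)).comp (Pi.evalMonoidHom _ i)

/-- The character `(gᵢ)ᵢ ↦ ∏ᵢ χᵢ(Nrᵢ(gᵢ))` of `G_char` associated with a tuple `(χᵢ)ᵢ` of
quadratic Hecke characters. -/
def tupleCharacter (a b : Fin (s + 1) → ℚ) (χ : Fin (s + 1) → quadraticHeckeCharacters) :
    GChar a b →* ℤˣ :=
  QuotientGroup.lift _ (prodCompNorm a b χ) (by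
    change rationalPlus a b ≤ (prodCompNorm a b χ).ker
    have key : ∀ g : AdelicG a b, (∀ i, compNorm (a i) (b i) (χ i) (g i) = 1) →
        g ∈ (prodCompNorm a b χ).ker := by
      intro g hg
      rw [MonoidHom.mem_ker, prodCompNorm, MonoidHom.finsetProd_apply]
      exact Finset.prod_eq_one fun i _ => hg i
    refine sup_le ?_ ?_
    · intro g hg
      refine key g fun i => ?_
      obtain ⟨x, hx⟩ := hg i (Set.mem_univ i)
      rw [← hx]
      have hu : IsUnit (redNorm (a i) (b i) (x : ℍ[ℚ,a i,b i])) := x.isUnit.map _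
      have h : ideleNorm (a i) (b i) (Units.map
          (rationalToAdelic (a i) (b i) : ℍ[ℚ,a i,b i] →* AdelicQuaternion (a i) (b i)) x)
          = principalIdele hu.unit := by
        ext1
        change redNorm _ _ (rationalToAdelic (a i) (b i) (x : ℍ[ℚ,a i,b i]))
          = algebraMap ℚ Adeles (redNorm (a i) (b i) (x : ℍ[ℚ,a i,b i]))
        simp [redNorm, rationalToAdelic]
      change (χ i : Adelesˣ →ₜ* ℤˣ) (ideleNorm (a i) (b i) _) = 1
      rw [h]
      exact (χ i).2 _
    · intro g hg
      refine key g fun i => ?_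
      obtain ⟨x, hx, hxg⟩ := hg i (Set.mem_univ i)
      rw [← hxg]
      change (χ i : Adelesˣ →ₜ* ℤˣ) (ideleNorm (a i) (b i) x) = 1
      rw [MonoidHom.mem_ker.mp hx, map_one])

/-! ### The diagonal torus -/

variable {K : Type*} [Field K] [NumberField K]

/-- The map `K(𝔸) = 𝔸 ⊗ K → B(𝔸)` induced by an embedding `K → B`. -/
def adelicEmbedding {a b : ℚ} (ι : K →ₐ[ℚ] ℍ[ℚ,a,b]) :
    Adeles ⊗[ℚ] K →ₐ[Adeles] AdelicQuaternion a b :=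
  Algebra.TensorProduct.lift (Algebra.ofId Adeles (AdelicQuaternion a b))
    ((rationalToAdelic a b).comp ι) (fun r _ => by
      rw [commute_iff_eq]
      exact Algebra.commutes r _)

variable {a b : Fin (s + 1) → ℚ}

/-- The diagonal map `T_K(𝔸) = K(𝔸)ˣ / 𝔸ˣ → G(𝔸)`, `t ↦ (ι₀(t), …, ι_s(t))`. -/
def torusMap (ι : ∀ i, K →ₐ[ℚ] ℍ[ℚ,a i,b i]) :
    ProjUnits Adeles (Adeles ⊗[ℚ] K) →* AdelicG a b :=
  MonoidHom.pi fun i => ProjUnits.map (adelicEmbedding (ι i))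

/-- The group `T_ι(𝔸)`, with the topology induced from `G(𝔸)`. -/
abbrev adelicTorus (ι : ∀ i, K →ₐ[ℚ] ℍ[ℚ,a i,b i]) : Subgroup (AdelicG a b) := (torusMap ι).range

/-- The subgroup `T_ι(ℚ)` of `T_ι(𝔸)`, the image of `Kˣ`. -/
def rationalTorus (ι : ∀ i, K →ₐ[ℚ] ℍ[ℚ,a i,b i]) : Subgroup (adelicTorus ι) :=
  ((torusMap ι).rangeRestrict.comp ((QuotientGroup.mk' _).comp
    (Units.map (Algebra.TensorProduct.includeRight : K →ₐ[ℚ] Adeles ⊗[ℚ] K).toMonoidHom))).range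

instance rationalTorus_normal (ι : ∀ i, K →ₐ[ℚ] ℍ[ℚ,a i,b i]) : (rationalTorus ι).Normal where
  conj_mem := by
    rintro n hn ⟨_, y, rfl⟩
    obtain ⟨_, x, rfl⟩ := n
    have h : (⟨torusMap ι y, y, rfl⟩ : adelicTorus ι) * ⟨torusMap ι x, x, rfl⟩ *
        (⟨torusMap ι y, y, rfl⟩ : adelicTorus ι)⁻¹ = ⟨torusMap ι x, x, rfl⟩ := by
      rw [mul_inv_eq_iff_eq_mul]
      ext1
      change torusMap ι y * torusMap ι x = torusMap ι x * torusMap ι y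
      rw [← map_mul, ← map_mul, mul_comm y x]
    rw [h]
    exact hn

/-- The compact abelian group `[T_ι] = T_ι(ℚ) \ T_ι(𝔸)`. -/
def TorusQuotient (ι : ∀ i, K →ₐ[ℚ] ℍ[ℚ,a i,b i]) : Type := adelicTorus ι ⧸ rationalTorus ι

variable (ι : ∀ i, K →ₐ[ℚ] ℍ[ℚ,a i,b i])

instance : Group (TorusQuotient ι) := inferInstanceAs (Group (adelicTorus ι ⧸ rationalTorus ι))

instance : TopologicalSpace (TorusQuotient ι) :=
  inferInstanceAs (TopologicalSpace (adelicTorus ι ⧸ rationalTorus ι))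

instance : MeasurableSpace (TorusQuotient ι) := borel _

instance : BorelSpace (TorusQuotient ι) := ⟨rfl⟩

/-- The map `[T_ι] → G_char` induced by the inclusion `T_ι(𝔸) ⊆ G(𝔸)`. -/
def torusToGChar : TorusQuotient ι →* GChar a b :=
  QuotientGroup.map (rationalTorus ι) (rationalPlus a b) (adelicTorus ι).subtype (by
    rintro _ ⟨x, rfl⟩
    refine Subgroup.mem_sup_left fun i _ => ⟨Units.map (ι i : K →* ℍ[ℚ,a i,b i]) x, ?_⟩
    change QuotientGroup.mk' _ _ = QuotientGroup.mk' _ _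
    congr 1
    ext1
    change _ = adelicEmbedding (ι i) (1 ⊗ₜ[ℚ] (x : K))
    rw [adelicEmbedding, Algebra.TensorProduct.lift_tmul, map_one, one_mul]
    rfl)

/-- The function `t ↦ χ(t)` on `[T_ι]`, where `χ` is the character of `G_char` associated with the
tuple `(χᵢ)ᵢ`. -/
def torusCharacter (χ : Fin (s + 1) → quadraticHeckeCharacters) (t : TorusQuotient ι) : ℂ :=
  ((tupleCharacter a b χ (torusToGChar ι t) : ℤˣ) : ℤ)

end TorusCharacter

end

open scoped NumberTheorySymbols

/-! ### Primes with prescribed Legendre symbols -/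

namespace TorusCharacter

/-! Write `K = ℚ(θ)` with `θ² = e`, `e ≠ 1` squarefree. Each embedding sends `θ` to a pure
quaternion of square `e`, so the reduced norm of the image of `x + yθ` is `x² - e y²` in every
factor, whatever the quaternion algebra (`redNorm_adelicEmbedding`). On the torus `χ` is therefore
`Π` evaluated at the norm form of `K` (`torusSign_eq_of_norm`). By invariance of Haar measure the
integral is `1` if this sign character is trivial and `0` otherwise. The case `Π = 1` is then
immediate.

For `Π ≠ 1` three arithmetic facts remain, all proved without class field theory.

Existence of `d` (`exists_squarefree_hasLegendreValues`): the restriction of `Π` to local units is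
trivial or the Legendre symbol at odd primes, and is one of the four characters modulo `8` at `2`.
The product formula at a good prime `p`, combined with quadratic reciprocity, gives the value at `p`
as `(d/p)`.

If `e = d`, then `Π` is trivial on norms (`apply_eq_one_of_norm`). An idele norm is approximated by
a rational number of the same form, closely at the bad primes and with the same sign at the real
place. The quotient is invisible to `Π` at the bad places, and at good primes both numbers are local
norms, on which the local character is trivial. With `e = 1` every idele is a norm, so a character
with trivial Legendre values is trivial; this is why `d ≠ 1`.

If `e ≠ d`, Dirichlet's theorem and reciprocity supply a prime inert for `d` and split for `e`
(`exists_prime_legendreSym`). There `x² - e` takes a value of valuation exactly one, on which `Π` is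
`-1` (`exists_norm_apply_eq_neg_one`). The same primes give the uniqueness of `d`. -/

theorem jacobiSym_eq_of_modEq {d : ℤ} {a b M : ℕ} (ha : Odd a) (hb : Odd b)
    (hM : 4 * d.natAbs ∣ M) (h : a ≡ b [MOD M]) : J(d | a) = J(d | b) := by
  rw [jacobiSym.mod_right d ha, jacobiSym.mod_right d hb]
  exact congrArg _ (h.of_dvd hM)

/-- If an odd prime `q` divides `d = q d'`, the Chinese remainder theorem gives `a` that is a
nonresidue modulo `q` and is `1` modulo `8|d'|`; reciprocity then makes `q` contribute `-1` and `d'`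
contribute `1`. Without odd prime factors only `-1` and `±2` are left. -/
theorem exists_jacobiSym_eq_neg_one {d : ℤ} (hd : Squarefree d) (hd1 : d ≠ 1) :
    ∃ a : ℕ, Odd a ∧ J(d | a) = -1 := by
  by_cases hq : ∃ q : ℕ, q.Prime ∧ q ≠ 2 ∧ (q : ℤ) ∣ d
  · obtain ⟨q, hqp, hq2, d', rfl⟩ := hq
    have := Fact.mk hqp
    have hqodd : Odd q := hqp.odd_of_ne_two hq2
    have hcop : Nat.Coprime q (8 * d'.natAbs) := by
      refine Nat.Coprime.mul_right ?_ ?_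
      · exact (Nat.coprime_pow_right_iff (by norm_num : 0 < 3) q 2).mpr
          (Nat.coprime_two_right.mpr hqodd)
      · have h := (squarefree_mul_iff.mp hd).1
        exact Int.isCoprime_iff_gcd_eq_one.mp h.isCoprime
    obtain ⟨r, hr⟩ := quadraticChar_exists_neg_one (F := ZMod q) (by rwa [ZMod.ringChar_zmod_n])
    obtain ⟨a, ha1, ha2⟩ := Nat.chineseRemainder hcop r.val 1
    have ha4 : a % 4 = 1 := ha2.of_dvd (Dvd.dvd.mul_right (by norm_num) _)
    have hao : Odd a := Nat.odd_iff.mpr (by omega)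
    refine ⟨a, hao, ?_⟩
    have h1 : J(d' | a) = 1 := by
      rw [jacobiSym_eq_of_modEq hao odd_one (Nat.mul_dvd_mul_right (by norm_num : 4 ∣ 8) _) ha2,
        jacobiSym.one_right]
    have h2 : J((q : ℤ) | a) = -1 := by
      rw [jacobiSym.quadratic_reciprocity_one_mod_four' hqodd ha4, ← jacobiSym.legendreSym.to_jacobiSym,
        legendreSym]
      have : ((a : ℤ) : ZMod q) = r := by
        rw [Int.cast_natCast, (ZMod.natCast_eq_natCast_iff _ _ _).mpr ha1, ZMod.natCast_zmod_val]
      rw [this, hr]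
    rw [jacobiSym.mul_left, h1, h2, mul_one]
  · push Not at hq
    have hsub : d.natAbs.primeFactors ⊆ {2} := by
      intro p hp
      rw [Finset.mem_singleton]
      by_contra h2
      exact hq p (Nat.prime_of_mem_primeFactors hp) h2
        (Int.natCast_dvd.mpr (Nat.dvd_of_mem_primeFactors hp))
    have hprod := Nat.prod_primeFactors_of_squarefree (Int.squarefree_natAbs.mpr hd)
    have key : d = -1 ∨ d = 2 ∨ d = -2 := by
      rcases Finset.subset_singleton_iff.mp hsub with h | h <;> rw [h] at hprod <;>
        simp at hprod <;> omega
    rcases key with rfl | rfl | rfl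
    · exact ⟨3, by decide, by norm_num⟩
    · exact ⟨3, by decide, by norm_num⟩
    · exact ⟨5, by decide, by norm_num⟩

theorem coprime_of_jacobiSym_ne_zero {d : ℤ} {a : ℕ} (ha : a ≠ 0) (h : J(d | a) ≠ 0) :
    Nat.Coprime a d.natAbs := by
  by_contra hc
  refine h (jacobiSym.eq_zero_iff.mpr ⟨ha, fun h1 => hc ?_⟩)
  rw [Nat.coprime_comm]
  exact h1

theorem exists_prime_modEq_of_odd {M : ℕ} (hM : M ≠ 0) {a : ℕ} (ha : Odd a)
    (haM : Nat.Coprime a M) (n : ℕ) :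
    ∃ p : ℕ, n < p ∧ p.Prime ∧ Odd p ∧ p ≡ a [MOD 4 * M] := by
  have hc : Nat.Coprime a (4 * M) :=
    ((Nat.coprime_pow_right_iff (by norm_num : 0 < 2) a 2).mpr
      (Nat.coprime_two_right.mpr ha)).mul_right haM
  obtain ⟨p, hp, hpp, hpa⟩ := Nat.forall_exists_prime_gt_and_modEq (max n 2)
    (by omega : 4 * M ≠ 0) hc
  exact ⟨p, (le_max_left _ _).trans_lt hp, hpp,
    hpp.odd_of_ne_two ((le_max_right _ _).trans_lt hp).ne', hpa⟩

/-- The symbol depends only on the class of the odd number below modulo `4|d|`, so Dirichlet's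
theorem replaces that number by a large prime. -/
theorem exists_prime_jacobiSym_eq_neg_one {d : ℤ} (hd : Squarefree d) (hd1 : d ≠ 1) (n : ℕ) :
    ∃ p : ℕ, n < p ∧ p.Prime ∧ Odd p ∧ J(d | p) = -1 := by
  obtain ⟨a, hao, ha⟩ := exists_jacobiSym_eq_neg_one hd hd1
  obtain ⟨p, hp, hpp, hpo, hpa⟩ := exists_prime_modEq_of_odd (Int.natAbs_ne_zero.mpr hd.ne_zero) hao
    (coprime_of_jacobiSym_ne_zero hao.pos.ne' (by rw [ha]; norm_num)) n
  exact ⟨p, hp, hpp, hpo, by rw [jacobiSym_eq_of_modEq hpo hao dvd_rfl hpa, ha]⟩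

/-- The product of two distinct squarefree integers is a nonzero square times a squarefree integer
different from `1`. -/
theorem exists_mul_eq_sq_mul_squarefree {d e : ℤ} (hd : Squarefree d) (he : Squarefree e)
    (hde : d ≠ e) : ∃ k g : ℤ, d * e = k ^ 2 * g ∧ Squarefree g ∧ g ≠ 1 := by
  have hg0 : 0 < Int.gcd d e := Int.gcd_pos_of_ne_zero_left _ hd.ne_zero
  obtain ⟨d', e', hcop, hd', he'⟩ := Int.exists_gcd_one hg0
  refine ⟨Int.gcd d e, d' * e', ?_, ?_, ?_⟩
  · exact (congrArg₂ (· * ·) hd' he').trans (by ring)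
  · rw [squarefree_mul_iff]
    exact ⟨(Int.isCoprime_iff_gcd_eq_one.mpr hcop).isRelPrime,
      hd.squarefree_of_dvd ⟨_, hd'⟩, he.squarefree_of_dvd ⟨_, he'⟩⟩
  · intro h
    have : d' = e' := Int.eq_of_mul_eq_one h
    exact hde (hd'.trans ((congrArg (· * _) this).trans he'.symm))

/-- For distinct squarefree integers `d ≠ 1` and `e` there are arbitrarily large primes that are
inert in `ℚ(√d)` and split in `ℚ(√e)`. -/
theorem exists_prime_legendreSym {d e : ℤ} (hd : Squarefree d) (hd1 : d ≠ 1) (he : Squarefree e)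
    (hde : d ≠ e) (n : ℕ) :
    ∃ p : ℕ, n < p ∧ p.Prime ∧ Odd p ∧ J(d | p) = -1 ∧ J(e | p) = 1 := by
  have hM : d.natAbs * e.natAbs ≠ 0 :=
    mul_ne_zero (Int.natAbs_ne_zero.mpr hd.ne_zero) (Int.natAbs_ne_zero.mpr he.ne_zero)
  suffices h : ∃ a : ℕ, Odd a ∧ J(d | a) = -1 ∧ J(e | a) = 1 by
    obtain ⟨a, hao, had, hae⟩ := h
    have hc : Nat.Coprime a (d.natAbs * e.natAbs) :=
      (coprime_of_jacobiSym_ne_zero hao.pos.ne' (by rw [had]; norm_num)).mul_right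
        (coprime_of_jacobiSym_ne_zero hao.pos.ne' (by rw [hae]; norm_num))
    obtain ⟨p, hp, hpp, hpo, hpa⟩ := exists_prime_modEq_of_odd hM hao hc n
    exact ⟨p, hp, hpp, hpo,
      by rw [jacobiSym_eq_of_modEq hpo hao (mul_dvd_mul_left _ (dvd_mul_right _ _)) hpa, had],
      by rw [jacobiSym_eq_of_modEq hpo hao (mul_dvd_mul_left _ (dvd_mul_left _ _)) hpa, hae]⟩
  have large : ∀ p : ℕ, p.Prime → d.natAbs * e.natAbs < p → (J(d | p) = 1 ∨ J(d | p) = -1) ∧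
      (J(e | p) = 1 ∨ J(e | p) = -1) := by
    intro p hp hlt
    have hcop : Nat.Coprime (d.natAbs * e.natAbs) p :=
      (hp.coprime_iff_not_dvd.mpr (Nat.not_dvd_of_pos_of_lt (Nat.pos_of_ne_zero hM) hlt)).symm
    exact ⟨jacobiSym.eq_one_or_neg_one hcop.coprime_mul_right,
      jacobiSym.eq_one_or_neg_one hcop.coprime_mul_left⟩
  obtain ⟨p, hp, hpp, hpo, hpd⟩ :=
    exists_prime_jacobiSym_eq_neg_one hd hd1 (d.natAbs * e.natAbs)
  rcases (large p hpp hp).2 with hpe | hpe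
  · exact ⟨p, hpo, hpd, hpe⟩
  -- Here both symbols at `p` are `-1`. A prime `q` where `de` has symbol `-1` has opposite symbols
  -- for `d` and `e`, so either `q` or `p * q` has the required pair of values.
  obtain ⟨k, g, hkg, hg, hg1⟩ := exists_mul_eq_sq_mul_squarefree hd he hde
  obtain ⟨q, hq, hqp, hqo, hqg⟩ :=
    exists_prime_jacobiSym_eq_neg_one hg hg1 (d.natAbs * e.natAbs)
  have hmul : J(d | q) * J(e | q) = J(k | q) ^ 2 * -1 := by
    rw [← jacobiSym.mul_left, hkg, jacobiSym.mul_left, jacobiSym.pow_left, hqg]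
  have hneg : J(d | q) * J(e | q) ≤ 0 := by
    rw [hmul]
    nlinarith [sq_nonneg J(k | q)]
  obtain ⟨hqd | hqd, hqe | hqe⟩ := large q hqp hq
  · rw [hqd, hqe] at hneg
    norm_num at hneg
  · refine ⟨p * q, hpo.mul hqo, ?_, ?_⟩
    · rw [jacobiSym.mul_right' _ hpp.ne_zero hqp.ne_zero, hpd, hqd, mul_one]
    · rw [jacobiSym.mul_right' _ hpp.ne_zero hqp.ne_zero, hpe, hqe]
      norm_num
  · exact ⟨q, hqo, hqd, hqe⟩
  · rw [hqd, hqe] at hneg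
    norm_num at hneg

end TorusCharacter

/-! ### Components of adeles and ideles -/

namespace TorusCharacter

open IsDedekindDomain Topology

/-- The finite places of `ℚ`. -/
abbrev FinitePlace : Type := HeightOneSpectrum ℤ

/-- The projection of the adele ring to the real place. -/
noncomputable def realComponent : Adeles →+* ℝ :=
  ((NumberField.InfinitePlace.Completion.ringEquivRealOfIsReal
    Rat.isReal_infinitePlace).toRingHom.comp (Pi.evalRingHom _ Rat.infinitePlace)).comp
    (RingHom.fst (NumberField.InfiniteAdeleRing ℚ) (FiniteAdeleRing ℤ ℚ))

/-- The projection of the adele ring to a finite place. -/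
noncomputable def finiteComponent (v : FinitePlace) : Adeles →+* v.adicCompletion ℚ where
  toFun x := x.2 v
  map_one' := rfl
  map_mul' _ _ := rfl
  map_zero' := rfl
  map_add' _ _ := rfl

theorem adele_ext {x y : Adeles} (h : realComponent x = realComponent y)
    (h' : ∀ v, finiteComponent v x = finiteComponent v y) : x = y := by
  refine Prod.ext (funext fun v => ?_) (FiniteAdeleRing.ext ℚ h')
  obtain rfl := Subsingleton.elim Rat.infinitePlace v
  exact (NumberField.InfinitePlace.Completion.ringEquivRealOfIsReal
    Rat.isReal_infinitePlace).injective h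

theorem exists_adele (r : ℝ) (x : FiniteAdeleRing ℤ ℚ) :
    ∃ y : Adeles, realComponent y = r ∧ ∀ v, finiteComponent v y = x v := by
  refine ⟨(fun w => Subsingleton.elim Rat.infinitePlace w ▸
    (NumberField.InfinitePlace.Completion.ringEquivRealOfIsReal
      Rat.isReal_infinitePlace).symm r, x), ?_, fun v => rfl⟩
  exact (NumberField.InfinitePlace.Completion.ringEquivRealOfIsReal
    Rat.isReal_infinitePlace).apply_symm_apply r

@[simp]
theorem realComponent_algebraMap (q : ℚ) : realComponent (algebraMap ℚ Adeles q) = q :=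
  eq_ratCast (realComponent.comp (algebraMap ℚ Adeles)) q

@[simp]
theorem finiteComponent_algebraMap (v : FinitePlace) (q : ℚ) :
    finiteComponent v (algebraMap ℚ Adeles q) = algebraMap ℚ (v.adicCompletion ℚ) q := rfl

theorem finiteComponent_integral (x : Adeles) :
    ∀ᶠ v in Filter.cofinite, Valued.v (finiteComponent v x) ≤ 1 := x.2.2

theorem valued_algebraMap (v : FinitePlace) (q : ℚ) :
    Valued.v (algebraMap ℚ (v.adicCompletion ℚ) q) = v.valuation ℚ q :=
  HeightOneSpectrum.valuedAdicCompletion_eq_valuation' v q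

theorem valued_intCast (v : FinitePlace) (n : ℤ) :
    Valued.v (n : v.adicCompletion ℚ) = v.intValuation n := by
  rw [← map_intCast (algebraMap ℚ (v.adicCompletion ℚ)), valued_algebraMap,
    ← HeightOneSpectrum.valuation_of_algebraMap (K := ℚ)]
  rfl

theorem valued_intCast_le_one (v : FinitePlace) (n : ℤ) :
    Valued.v (n : v.adicCompletion ℚ) ≤ 1 := by
  rw [valued_intCast]
  exact v.intValuation_le_one n

theorem valued_natCast_le_one (v : FinitePlace) (n : ℕ) :
    Valued.v (n : v.adicCompletion ℚ) ≤ 1 := by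
  simpa using valued_intCast_le_one v n

theorem natCast_adicCompletion_ne_zero (v : FinitePlace) {n : ℕ} (hn : n ≠ 0) :
    (n : v.adicCompletion ℚ) ≠ 0 := by
  rw [← map_natCast (algebraMap ℚ (v.adicCompletion ℚ))]
  exact (map_ne_zero _).mpr (Nat.cast_ne_zero.mpr hn)

theorem exists_eq_placeOfPrime (v : FinitePlace) :
    ∃ (p : ℕ) (hp : Fact p.Prime), v = @placeOfPrime p hp := by
  obtain ⟨g, hg⟩ := (IsPrincipalIdealRing.principal v.asIdeal).principal
  change v.asIdeal = Ideal.span {g} at hg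
  have hg0 : g ≠ 0 := fun h => v.ne_bot (by rw [hg, h, Ideal.span_singleton_eq_bot])
  have hgp : Prime g := (Ideal.span_singleton_prime hg0).mp (hg ▸ v.isPrime)
  refine ⟨g.natAbs, ⟨Int.prime_iff_natAbs_prime.mp hgp⟩, HeightOneSpectrum.ext ?_⟩
  change v.asIdeal = Ideal.span {(g.natAbs : ℤ)}
  rw [hg, Int.span_natAbs]

theorem placeOfPrime_injective {p q : ℕ} [hp : Fact p.Prime] [hq : Fact q.Prime]
    (h : placeOfPrime p = placeOfPrime q) : p = q := by
  have h1 : Ideal.span {(p : ℤ)} = Ideal.span {(q : ℤ)} := congrArg (·.asIdeal) h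
  rw [Ideal.span_singleton_eq_span_singleton, Int.associated_iff_natAbs] at h1
  simpa using h1

/-! ### Valuations of integers at the place of a prime. -/

section prime

variable (p : ℕ) [hp : Fact p.Prime]

theorem valued_intCast_le_iff (k : ℕ) (n : ℤ) :
    Valued.v (n : (placeOfPrime p).adicCompletion ℚ) ≤ WithZero.exp (-(k : ℤ)) ↔
      (p : ℤ) ^ k ∣ n := by
  rw [valued_intCast, HeightOneSpectrum.intValuation_le_pow_iff_mem]
  change n ∈ Ideal.span {(p : ℤ)} ^ k ↔ _
  rw [Ideal.span_singleton_pow, Ideal.mem_span_singleton]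

theorem valued_intCast_lt_one_iff (n : ℤ) :
    Valued.v (n : (placeOfPrime p).adicCompletion ℚ) < 1 ↔ (p : ℤ) ∣ n := by
  rw [valued_intCast, HeightOneSpectrum.intValuation_lt_one_iff_mem]
  exact Ideal.mem_span_singleton

theorem valued_natCast_lt_one_iff (n : ℕ) :
    Valued.v (n : (placeOfPrime p).adicCompletion ℚ) < 1 ↔ p ∣ n := by
  rw [← Int.natCast_dvd_natCast, ← valued_intCast_lt_one_iff, Int.cast_natCast]

theorem valued_intCast_eq_one_iff (n : ℤ) :
    Valued.v (n : (placeOfPrime p).adicCompletion ℚ) = 1 ↔ ¬ (p : ℤ) ∣ n := by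
  rw [← valued_intCast_lt_one_iff, not_lt]
  exact ⟨fun h => h.ge, fun h => le_antisymm (valued_intCast_le_one _ n) h⟩

theorem valued_prime :
    Valued.v (p : (placeOfPrime p).adicCompletion ℚ) = WithZero.exp (-1 : ℤ) := by
  have := valued_intCast (placeOfPrime p) p
  rw [Int.cast_natCast] at this
  rw [this]
  exact (placeOfPrime p).intValuation_singleton
    (Nat.cast_ne_zero.mpr hp.out.ne_zero) rfl

end prime

/-- Every neighbourhood of `1` in the ring of local integers contains a congruence
neighbourhood. -/
theorem exists_congruence_subset (v : FinitePlace) {t : Set (v.adicCompletionIntegers ℚ)}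
    (ht : t ∈ 𝓝 1) : ∃ n : ℕ, n ≠ 0 ∧ ∀ x : v.adicCompletionIntegers ℚ,
      Valued.v ((x : v.adicCompletion ℚ) - 1) ≤ Valued.v (n : v.adicCompletion ℚ) → x ∈ t := by
  obtain ⟨s, hs, hst⟩ := mem_nhds_induced _ _ _ |>.mp ht
  obtain ⟨γ, hγ⟩ := Valued.mem_nhds.mp hs
  obtain ⟨p, hp, rfl⟩ := exists_eq_placeOfPrime v
  have hγ0 : MonoidWithZeroHom.ValueGroup₀.embedding γ.1 ≠ 0 := by simp
  obtain ⟨k, hk⟩ := exists_pow_lt₀ (show WithZero.exp (-1 : ℤ) < 1 from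
    WithZero.exp_lt_exp.mpr (by norm_num) |>.trans_eq WithZero.exp_zero) (Units.mk0 _ hγ0)
  refine ⟨p ^ k, pow_ne_zero _ hp.out.ne_zero, fun x hx => hst (hγ ?_)⟩
  rw [Set.mem_ofPred_eq, Valuation.restrict_lt_iff_lt_embedding]
  refine hx.trans_lt ?_
  rw [Nat.cast_pow, map_pow, valued_prime]
  exact hk

/-! ### Local ideles -/

@[simp]
theorem realComponent_localIdele (v : FinitePlace) (x : (v.adicCompletion ℚ)ˣ) :
    realComponent (localIdele v x : Adeles) = 1 :=
  map_one (NumberField.InfinitePlace.Completion.ringEquivRealOfIsReal Rat.isReal_infinitePlace)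

@[simp]
theorem finiteComponent_localIdele_same (v : FinitePlace) (x : (v.adicCompletion ℚ)ˣ) :
    finiteComponent v (localIdele v x : Adeles) = x := by
  classical
  exact congrArg Units.val (Pi.mulSingle_eq_same (M := fun w : FinitePlace =>
    (w.adicCompletion ℚ)ˣ) v x)

theorem finiteComponent_localIdele_of_ne {v w : FinitePlace} (h : w ≠ v)
    (x : (v.adicCompletion ℚ)ˣ) : finiteComponent w (localIdele v x : Adeles) = 1 := by
  classical
  exact congrArg Units.val (Pi.mulSingle_eq_of_ne (M := fun w : FinitePlace =>
    (w.adicCompletion ℚ)ˣ) h x)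

theorem idele_ext {x y : Adelesˣ} (h : realComponent x = realComponent y)
    (h' : ∀ v, finiteComponent v (x : Adeles) = finiteComponent v (y : Adeles)) : x = y :=
  Units.ext (adele_ext h h')

/-- `localIdele` as a homomorphism. -/
noncomputable def localIdeleHom (v : FinitePlace) : (v.adicCompletion ℚ)ˣ →* Adelesˣ where
  toFun := localIdele v
  map_one' := by
    refine idele_ext (by simp) fun w => ?_
    by_cases h : w = v
    · subst h; simp
    · rw [finiteComponent_localIdele_of_ne h]; simp
  map_mul' x y := by
    refine idele_ext (by simp) fun w => ?_
    by_cases h : w = v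
    · subst h; simp
    · simp [finiteComponent_localIdele_of_ne h]

/-- The component of an idele at a finite place. -/
noncomputable abbrev ideleComponent (v : FinitePlace) : Adelesˣ →* (v.adicCompletion ℚ)ˣ :=
  Units.map (finiteComponent v).toMonoidHom

/-! ### Conductors -/

/-- `N` is a modulus for the idele character `ψ`. -/
def IsModulus (ψ : Adelesˣ →ₜ* ℤˣ) (N : ℕ) : Prop :=
  N ≠ 0 ∧ ∀ u : Adelesˣ, 0 < realComponent u →
    (∀ v, Valued.v (finiteComponent v (u : Adeles)) = 1 ∧
      Valued.v (finiteComponent v (u : Adeles) - 1) ≤ Valued.v (N : v.adicCompletion ℚ)) →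
    ψ u = 1

/-- The embedding of the finite integral adeles into the adeles, as a monoid homomorphism. -/
noncomputable def integralAdele :
    (∀ v : FinitePlace, v.adicCompletionIntegers ℚ) →* Adeles where
  toFun x := ((1 : NumberField.InfiniteAdeleRing ℚ),
    (RestrictedProduct.structureMap (fun v : FinitePlace => v.adicCompletion ℚ)
      (fun v => (v.adicCompletionIntegers ℚ : Set (v.adicCompletion ℚ))) Filter.cofinite x :
      FiniteAdeleRing ℤ ℚ))
  map_one' := rfl
  map_mul' _ _ := Prod.ext (mul_one _).symm rfl

theorem continuous_integralAdele : Continuous integralAdele :=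
  Continuous.prodMk (f := fun _ => (1 : NumberField.InfiniteAdeleRing ℚ)) continuous_const
    (RestrictedProduct.isEmbedding_structureMap (R := fun v : FinitePlace => v.adicCompletion ℚ)
      (A := fun v => (v.adicCompletionIntegers ℚ : Set (v.adicCompletion ℚ)))
      (𝓕 := Filter.cofinite)).continuous

@[simp]
theorem realComponent_integralAdele (x : ∀ v : FinitePlace, v.adicCompletionIntegers ℚ) :
    realComponent (integralAdele x) = 1 :=
  map_one (NumberField.InfinitePlace.Completion.ringEquivRealOfIsReal Rat.isReal_infinitePlace)

@[simp]
theorem finiteComponent_integralAdele (x : ∀ v : FinitePlace, v.adicCompletionIntegers ℚ)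
    (v : FinitePlace) : finiteComponent v (integralAdele x) = x v := rfl

/-- Congruence of a unit to `1` is inherited by the inverse. -/
theorem valued_inv_sub_one {v : FinitePlace} {x : v.adicCompletion ℚ} (hx : Valued.v x = 1) :
    Valued.v (x⁻¹ - 1) = Valued.v (x - 1) := by
  have hx0 : x ≠ 0 := fun h => by simp [h] at hx
  have : x⁻¹ - 1 = -(x⁻¹ * (x - 1)) := by field_simp; ring
  rw [this, Valuation.map_neg, map_mul, map_inv₀, hx, inv_one, one_mul]

/-- The kernel is open because `{±1}` is discrete, and a basic neighbourhood of `1` in the integral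
ideles restricts only finitely many places. The real component imposes no congruence: a positive
real is a square, hence is killed by a sign character. -/
theorem exists_modulus (ψ : Adelesˣ →ₜ* ℤˣ) : ∃ N, IsModulus ψ N := by
  classical
  set f : (∀ v : FinitePlace, v.adicCompletionIntegers ℚ)ˣ →* ℤˣ :=
    (ψ : Adelesˣ →* ℤˣ).comp (Units.map integralAdele) with hf
  have hfc : Continuous f := ψ.continuous_toFun.comp
    (Continuous.units_map _ continuous_integralAdele)
  have h1 : f ⁻¹' {1} ∈ 𝓝 1 := (isOpen_discrete _).preimage hfc |>.mem_nhds (by simp)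
  -- The topology on units comes from `u ↦ (u, u⁻¹)`, so the inverse must satisfy the congruences
  -- too; `valued_inv_sub_one` provides this.
  rw [Units.isInducing_embedProduct.nhds_eq_comap, Filter.mem_comap] at h1
  obtain ⟨W, hW, hWf⟩ := h1
  rw [map_one, ← Prod.mk_one_one, mem_nhds_prod_iff] at hW
  obtain ⟨W₁, hW₁, W₂, hW₂, hWW⟩ := hW
  have hW₂' : MulOpposite.op ⁻¹' W₂ ∈ 𝓝 (1 : ∀ v : FinitePlace, v.adicCompletionIntegers ℚ) :=
    MulOpposite.continuous_op.continuousAt hW₂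
  have hW := Filter.inter_mem hW₁ hW₂'
  rw [nhds_pi, Filter.mem_pi'] at hW
  obtain ⟨I, t, ht, htW⟩ := hW
  choose n hn0 hn using fun v => exists_congruence_subset v (ht v)
  refine ⟨∏ v ∈ I, n v, Finset.prod_ne_zero_iff.mpr fun v _ => hn0 v, fun u hpos hu => ?_⟩
  have hle : ∀ v ∈ I, Valued.v ((∏ w ∈ I, n w : ℕ) : v.adicCompletion ℚ)
      ≤ Valued.v (n v : v.adicCompletion ℚ) := by
    intro v hv
    rw [← Finset.mul_prod_erase I n hv, Nat.cast_mul, map_mul]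
    exact mul_le_of_le_one_right' (valued_natCast_le_one v _)
  have hu0 : ∀ v, finiteComponent v (u : Adeles) ≠ 0 :=
    fun v => (u.isUnit.map (finiteComponent v)).ne_zero
  let x : (∀ v : FinitePlace, v.adicCompletionIntegers ℚ)ˣ :=
    { val := fun v => ⟨finiteComponent v (u : Adeles), (hu v).1.le⟩
      inv := fun v => ⟨(finiteComponent v (u : Adeles))⁻¹, by
        rw [HeightOneSpectrum.mem_adicCompletionIntegers, map_inv₀, (hu v).1, inv_one]⟩
      val_inv := funext fun v => Subtype.ext (mul_inv_cancel₀ (hu0 v))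
      inv_val := funext fun v => Subtype.ext (inv_mul_cancel₀ (hu0 v)) }
  have hx : f x = 1 := by
    apply hWf
    apply hWW
    have hmem : ∀ y : ∀ v : FinitePlace, v.adicCompletionIntegers ℚ,
        (∀ v, Valued.v ((y v : v.adicCompletion ℚ) - 1)
          ≤ Valued.v ((∏ w ∈ I, n w : ℕ) : v.adicCompletion ℚ)) →
        y ∈ W₁ ∩ MulOpposite.op ⁻¹' W₂ :=
      fun y hy => htW fun v hv => hn v _ ((hy v).trans (hle v hv))
    exact ⟨(hmem x.val fun v => (hu v).2).1,
      (hmem x.inv fun v => (valued_inv_sub_one (hu v).1).trans_le (hu v).2).2⟩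
  -- The idele `w` has the square root of the real component of `u` at the real place and `1`
  -- elsewhere, so `u` differs from an integral idele by `w²`.
  obtain ⟨y, hy, hy'⟩ := exists_adele (Real.sqrt (realComponent u)) 1
  obtain ⟨z, hz, hz'⟩ := exists_adele (Real.sqrt (realComponent u))⁻¹ 1
  have hyz : y * z = 1 := adele_ext
    (by rw [map_mul, hy, hz, mul_inv_cancel₀ (Real.sqrt_pos.mpr hpos).ne', map_one])
    (fun v => by rw [map_mul, hy', hz', map_one]; exact mul_one _)
  let w : Adelesˣ := ⟨y, z, hyz, by rw [mul_comm, hyz]⟩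
  have huw : u = w * w * Units.map integralAdele x := by
    refine idele_ext ?_ fun v => ?_
    · simp only [Units.val_mul, map_mul, Units.coe_map]
      change _ = realComponent y * realComponent y * realComponent (integralAdele x)
      rw [hy, realComponent_integralAdele, Real.mul_self_sqrt hpos.le, mul_one]
    · simp only [Units.val_mul, map_mul, Units.coe_map]
      change _ = finiteComponent v y * finiteComponent v y * finiteComponent v (integralAdele x)
      rw [hy', finiteComponent_integralAdele]
      change finiteComponent v (u : Adeles) = 1 * 1 * finiteComponent v (u : Adeles)
      rw [one_mul, one_mul]
  rw [huw, map_mul, map_mul, Int.units_mul_self, one_mul]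
  exact hx

/-- Dividing `u` by its local ideles at the places of `T` leaves an idele equal to `1` on `T` and
congruent to `1` elsewhere, which the modulus condition kills. -/
theorem IsModulus.apply_eq_prod {ψ : Adelesˣ →ₜ* ℤˣ} {N : ℕ} (hN : IsModulus ψ N)
    (T : Finset FinitePlace) {u : Adelesˣ} (hpos : 0 < realComponent u)
    (hu : ∀ v ∉ T, Valued.v (finiteComponent v (u : Adeles)) = 1 ∧
      Valued.v (finiteComponent v (u : Adeles) - 1) ≤ Valued.v (N : v.adicCompletion ℚ)) :
    ψ u = ∏ v ∈ T, ψ (localIdele v (ideleComponent v u)) := by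
  classical
  set y : Adelesˣ := ∏ v ∈ T, localIdele v (ideleComponent v u) with hy
  have hyv : ∀ v, finiteComponent v (y : Adeles) =
      if v ∈ T then finiteComponent v (u : Adeles) else 1 := by
    intro v
    rw [hy, Units.coe_prod, map_prod]
    split_ifs with hv
    · rw [Finset.prod_eq_single_of_mem v hv fun w _ hwv =>
        finiteComponent_localIdele_of_ne hwv.symm _, finiteComponent_localIdele_same]
      rfl
    · exact Finset.prod_eq_one fun w hw =>
        finiteComponent_localIdele_of_ne (fun h : v = w => hv (h ▸ hw)) _
  have hyr : realComponent (y : Adeles) = 1 := by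
    rw [hy, Units.coe_prod, map_prod]
    exact Finset.prod_eq_one fun w _ => realComponent_localIdele _ _
  have huy : ψ (u * y⁻¹) = 1 := by
    have hmul : ((u * y⁻¹ : Adelesˣ) : Adeles) * y = u := by simp
    refine hN.2 _ ?_ fun v => ?_
    · have := congrArg realComponent hmul
      rw [map_mul, hyr, mul_one] at this
      rwa [this]
    · have h := congrArg (finiteComponent v) hmul
      rw [map_mul, hyv] at h
      split_ifs at h with hv
      · have hu0 : finiteComponent v (u : Adeles) ≠ 0 := (u.isUnit.map (finiteComponent v)).ne_zero
        rw [mul_eq_right₀ hu0] at h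
        rw [h]
        simp
      · rw [mul_one] at h
        rw [h]
        exact hu v hv
  rw [map_mul, map_inv, mul_inv_eq_one] at huy
  rw [huy, hy, map_prod]

end TorusCharacter

/-! ### Approximation by integers -/

namespace TorusCharacter

open IsDedekindDomain Topology

/-- Density of `ℚ` in the completion gives a `v`-integral rational approximation, which is then
approximated by an integer. -/
theorem exists_intCast_sub_le (v : FinitePlace) {x : v.adicCompletion ℚ} (hx : Valued.v x ≤ 1)
    {n : ℕ} (hn : n ≠ 0) :
    ∃ a : ℤ, Valued.v (x - a) ≤ Valued.v (n : v.adicCompletion ℚ) := by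
  have hn0 : Valued.v (n : v.adicCompletion ℚ) ≠ 0 :=
    (Valuation.ne_zero_iff _).mpr (natCast_adicCompletion_ne_zero v hn)
  have hs : {y | Valued.v (y - x) < Valued.v (n : v.adicCompletion ℚ)} ∈ 𝓝 x := by
    refine Valued.mem_nhds.mpr ⟨Units.mk0 (Valued.v.restrict (n : v.adicCompletion ℚ)) ?_,
      fun y hy => ?_⟩
    · simpa using natCast_adicCompletion_ne_zero v hn
    · exact (Valuation.restrict_lt_iff _).mp hy
  obtain ⟨q, hq⟩ := (HeightOneSpectrum.denseRange_algebraMap (K := ℚ) v).exists_mem_open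
    isOpen_interior ⟨x, mem_interior_iff_mem_nhds.mpr hs⟩
  replace hq : Valued.v (algebraMap ℚ (v.adicCompletion ℚ) q - x) <
    Valued.v (n : v.adicCompletion ℚ) := interior_subset (s := {y | Valued.v (y - x) < _}) hq
  have hq1 : v.valuation ℚ q ≤ 1 := by
    rw [← valued_algebraMap]
    have := Valuation.map_add Valued.v (algebraMap ℚ (v.adicCompletion ℚ) q - x) x
    rw [sub_add_cancel] at this
    exact this.trans (max_le (hq.le.trans (valued_natCast_le_one v n)) hx)
  obtain ⟨a, ha⟩ := v.exists_valuation_sub_lt_of_integer hq1 (Units.mk0 _ hn0)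
  refine ⟨a, ?_⟩
  have ha' : Valued.v ((a : v.adicCompletion ℚ) - algebraMap ℚ (v.adicCompletion ℚ) q) <
      Valued.v (n : v.adicCompletion ℚ) := by
    have h := valued_algebraMap v (algebraMap ℤ ℚ a - q)
    rw [map_sub, eq_intCast, map_intCast] at h
    rw [h]
    exact ha
  have h := Valuation.map_add Valued.v ((a : v.adicCompletion ℚ) - algebraMap ℚ _ q)
    (algebraMap ℚ (v.adicCompletion ℚ) q - x)
  rw [sub_add_sub_cancel] at h
  rw [Valuation.map_sub_swap]
  exact h.trans (max_le ha'.le hq.le)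

theorem exists_pow_le_valued (v : FinitePlace) {x : v.adicCompletion ℚ} (hx : x ≠ 0) :
    ∃ k : ℕ, WithZero.exp (-(k : ℤ)) ≤ Valued.v x := by
  obtain ⟨k, hk⟩ := exists_pow_lt₀ (show WithZero.exp (-1 : ℤ) < 1 from
    WithZero.exp_lt_exp.mpr (by norm_num) |>.trans_eq WithZero.exp_zero)
    (Units.mk0 _ ((Valuation.ne_zero_iff Valued.v).mpr hx))
  refine ⟨k, le_of_eq_of_le ?_ hk.le⟩
  rw [← WithZero.exp_nsmul]
  simp

theorem eventually_valued_eq_one (u : Adelesˣ) :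
    ∀ᶠ v in Filter.cofinite, Valued.v (finiteComponent v (u : Adeles)) = 1 := by
  filter_upwards [finiteComponent_integral u, finiteComponent_integral (u⁻¹ : Adelesˣ)]
    with v h1 h2
  refine le_antisymm h1 ?_
  have h := congrArg (fun x => Valued.v (finiteComponent v x)) u.mul_inv
  simp only [map_mul, map_one] at h
  calc 1 = _ := h.symm
    _ ≤ Valued.v (finiteComponent v (u : Adeles)) := mul_le_of_le_one_right' h2

theorem ideleComponent_principalIdele (v : FinitePlace) (q : ℚˣ) :
    (ideleComponent v (principalIdele q) : v.adicCompletion ℚ) = algebraMap ℚ _ (q : ℚ) := rfl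

/-- An integral finite adele is congruent to an integer modulo any nonzero integer. -/
theorem exists_int_forall_sub_le (x : ∀ v : FinitePlace, v.adicCompletion ℚ)
    (hx : ∀ v, Valued.v (x v) ≤ 1) {n : ℕ} (hn : n ≠ 0) :
    ∃ a : ℤ, ∀ v, Valued.v (x v - a) ≤ Valued.v (n : v.adicCompletion ℚ) := by
  classical
  -- Only the finitely many places where `n` is not a unit impose a congruence, so the Chinese
  -- remainder theorem applies; elsewhere integrality suffices.
  have hfin := eventually_valued_eq_one (principalIdele (Units.mk0 (n : ℚ) (Nat.cast_ne_zero.mpr hn)))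
  choose b hb using fun v => exists_intCast_sub_le v (hx v) hn
  choose k hk using fun v : FinitePlace => exists_pow_le_valued v
    (natCast_adicCompletion_ne_zero v hn)
  obtain ⟨a, ha⟩ := IsDedekindDomain.exists_forall_sub_mem_ideal (s := hfin.toFinset)
    (fun v : FinitePlace => v.asIdeal) k (fun v _ => v.prime)
    (fun v _ w _ hvw h => hvw (HeightOneSpectrum.ext h)) (fun v => b v)
  refine ⟨a, fun v => ?_⟩
  by_cases hv : v ∈ hfin.toFinset
  · have h := ha v hv
    rw [← HeightOneSpectrum.intValuation_le_pow_iff_mem, ← valued_intCast, Int.cast_sub,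
      Valuation.map_sub_swap] at h
    rw [← sub_add_sub_cancel (x v) (b v : v.adicCompletion ℚ)]
    exact (Valuation.map_add _ _ _).trans (max_le (hb v) (h.trans (hk v)))
  · have h1 : Valued.v (n : v.adicCompletion ℚ) = 1 := by
      simpa [principalIdele] using hv
    rw [h1]
    exact (Valuation.map_sub _ _ _).trans (max_le (hx v) (valued_intCast_le_one v a))

theorem exists_natCast_mul_le_one (x : Adeles) :
    ∃ D : ℕ, D ≠ 0 ∧ ∀ v, Valued.v (D * finiteComponent v x) ≤ 1 := by
  classical
  have hfin := finiteComponent_integral x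
  have hloc : ∀ v : FinitePlace, ∃ n : ℕ, n ≠ 0 ∧ Valued.v (n * finiteComponent v x) ≤ 1 := by
    intro v
    obtain ⟨b, hb, hxb⟩ := HeightOneSpectrum.adicCompletion.mul_nonZeroDivisor_mem_adicCompletionIntegers
      (K := ℚ) v (finiteComponent v x)
    refine ⟨b.natAbs, Int.natAbs_ne_zero.mpr (nonZeroDivisors.ne_zero hb), ?_⟩
    have h : Valued.v ((b.natAbs : ℕ) : v.adicCompletion ℚ) = Valued.v (b : v.adicCompletion ℚ) := by
      rcases Int.natAbs_eq b with h | h <;> conv_rhs => rw [h]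
      · simp
      · simp
    rw [map_mul, h, ← map_mul, mul_comm]
    rw [HeightOneSpectrum.mem_adicCompletionIntegers] at hxb
    simpa using hxb
  choose n hn0 hn using hloc
  refine ⟨∏ v ∈ hfin.toFinset, n v, Finset.prod_ne_zero_iff.mpr fun v _ => hn0 v, fun v => ?_⟩
  by_cases hv : v ∈ hfin.toFinset
  · rw [← Finset.prod_erase_mul _ n hv, Nat.cast_mul, mul_assoc, map_mul]
    exact mul_le_one' (valued_natCast_le_one v _) (hn v)
  · rw [map_mul]
    refine mul_le_one' (valued_natCast_le_one v _) ?_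
    simpa using hfin.mem_toFinset.not.mp hv

/-! ### Local characters -/

/-- The local component of an idele character at a finite place. -/
noncomputable def localCharacter (ψ : Adelesˣ →ₜ* ℤˣ) (v : FinitePlace) :
    (v.adicCompletion ℚ)ˣ →* ℤˣ :=
  (ψ : Adelesˣ →* ℤˣ).comp (localIdeleHom v)

theorem localCharacter_apply (ψ : Adelesˣ →ₜ* ℤˣ) (v : FinitePlace) (x : (v.adicCompletion ℚ)ˣ) :
    localCharacter ψ v x = ψ (localIdele v x) := rfl

theorem IsModulus.localCharacter_eq_one {ψ : Adelesˣ →ₜ* ℤˣ} {N : ℕ} (hN : IsModulus ψ N)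
    {v : FinitePlace} {x : (v.adicCompletion ℚ)ˣ} (hx : Valued.v (x : v.adicCompletion ℚ) = 1)
    (hx' : Valued.v ((x : v.adicCompletion ℚ) - 1) ≤ Valued.v (N : v.adicCompletion ℚ)) :
    localCharacter ψ v x = 1 := by
  refine hN.2 (localIdele v x) (by rw [realComponent_localIdele]; exact one_pos) fun w => ?_
  by_cases h : w = v
  · subst h
    rw [finiteComponent_localIdele_same]
    exact ⟨hx, hx'⟩
  · rw [finiteComponent_localIdele_of_ne h]
    simp

theorem valued_sub_one_le {v : FinitePlace} {x : v.adicCompletion ℚ} (hx : Valued.v x = 1)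
    {N : ℕ} (hN : Valued.v (N : v.adicCompletion ℚ) = 1) :
    Valued.v (x - 1) ≤ Valued.v (N : v.adicCompletion ℚ) := by
  rw [hN]
  exact (Valuation.map_sub _ _ _).trans (max_le hx.le (map_one _).le)

theorem IsModulus.localCharacter_eq_one_of_not_dvd {ψ : Adelesˣ →ₜ* ℤˣ} {N : ℕ}
    (hN : IsModulus ψ N) {p : ℕ} [Fact p.Prime] (hp : ¬ p ∣ N)
    {x : ((placeOfPrime p).adicCompletion ℚ)ˣ}
    (hx : Valued.v (x : (placeOfPrime p).adicCompletion ℚ) = 1) :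
    localCharacter ψ (placeOfPrime p) x = 1 := by
  refine hN.localCharacter_eq_one hx (valued_sub_one_le hx ?_)
  have := (valued_intCast_eq_one_iff p N).mpr (by exact_mod_cast hp)
  simpa using this

/-! ### The norm form at a prime. -/

section prime

variable (p : ℕ) [hp : Fact p.Prime]

theorem coe_primeUniformizer :
    (primeUniformizer p : (placeOfPrime p).adicCompletion ℚ) = p :=
  map_natCast (algebraMap ℚ ((placeOfPrime p).adicCompletion ℚ)) p

/-- Every nonzero element becomes a unit after multiplication by a power of the uniformizer. -/
theorem exists_zpow_mul_valued_eq_one {x : (placeOfPrime p).adicCompletion ℚ} (hx : x ≠ 0) :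
    ∃ k : ℤ, Valued.v
      (((primeUniformizer p ^ k : ((placeOfPrime p).adicCompletion ℚ)ˣ) :
        (placeOfPrime p).adicCompletion ℚ) * x) = 1 := by
  have h0 : Valued.v x ≠ 0 := (Valuation.ne_zero_iff _).mpr hx
  refine ⟨WithZero.log (Valued.v x), ?_⟩
  rw [map_mul, Units.val_zpow_eq_zpow_val, map_zpow₀, coe_primeUniformizer, valued_prime,
    ← WithZero.exp_zsmul]
  conv_lhs => rw [← WithZero.exp_log h0]
  rw [WithZero.log_exp, ← WithZero.exp_add]
  simp

variable {p}

/-- For a nonresidue `e` the form is anisotropic modulo `p`, so a primitive pair gives a unit.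
Approximating by integers modulo `p` reduces this to `legendreSym.prime_dvd_of_eq_neg_one`. -/
theorem valued_sq_sub_mul_sq_eq_one {e : ℤ} (he : legendreSym p e = -1)
    {x y : (placeOfPrime p).adicCompletion ℚ} (hx : Valued.v x ≤ 1) (hy : Valued.v y ≤ 1)
    (hxy : Valued.v x = 1 ∨ Valued.v y = 1) : Valued.v (x ^ 2 - e * y ^ 2) = 1 := by
  have hp1 : Valued.v (p : (placeOfPrime p).adicCompletion ℚ) < 1 := by
    rw [valued_prime]
    exact WithZero.exp_lt_exp.mpr (by norm_num) |>.trans_eq WithZero.exp_zero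
  obtain ⟨X, hX⟩ := exists_intCast_sub_le _ hx hp.out.ne_zero
  obtain ⟨Y, hY⟩ := exists_intCast_sub_le _ hy hp.out.ne_zero
  replace hX := hX.trans_lt hp1
  replace hY := hY.trans_lt hp1
  have hle : Valued.v (x ^ 2 - e * y ^ 2) ≤ 1 := by
    refine (Valuation.map_sub _ _ _).trans (max_le ?_ ?_)
    · rw [map_pow]; exact pow_le_one' hx 2
    · rw [map_mul, map_pow]
      exact mul_le_one' (valued_intCast_le_one _ e) (pow_le_one' hy 2)
  refine le_antisymm hle (not_lt.mp fun hlt => ?_)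
  have key : Valued.v ((X ^ 2 - e * Y ^ 2 : ℤ) : (placeOfPrime p).adicCompletion ℚ) < 1 := by
    have h : ((X ^ 2 - e * Y ^ 2 : ℤ) : (placeOfPrime p).adicCompletion ℚ) =
        (x ^ 2 - e * y ^ 2) - ((x - X) * (x + X) - (e * (y + Y)) * (y - Y)) := by
      push_cast; ring
    rw [h]
    refine (Valuation.map_sub _ _ _).trans_lt (max_lt hlt
      ((Valuation.map_sub _ _ _).trans_lt (max_lt ?_ ?_)))
    · rw [map_mul]
      exact (mul_le_of_le_one_right' ((Valuation.map_add _ _ _).trans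
        (max_le hx (valued_intCast_le_one _ _)))).trans_lt hX
    · rw [map_mul, map_mul]
      exact (mul_le_of_le_one_left' (mul_le_one' (valued_intCast_le_one _ _)
        ((Valuation.map_add _ _ _).trans (max_le hy (valued_intCast_le_one _ _))))).trans_lt hY
  rw [valued_intCast_lt_one_iff] at key
  obtain ⟨h1, h2⟩ := legendreSym.prime_dvd_of_eq_neg_one he key
  rw [← valued_intCast_lt_one_iff] at h1 h2
  have h1' : Valued.v x < 1 := by
    rw [← sub_add_cancel x (X : (placeOfPrime p).adicCompletion ℚ)]
    exact (Valuation.map_add _ _ _).trans_lt (max_lt hX h1)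
  have h2' : Valued.v y < 1 := by
    rw [← sub_add_cancel y (Y : (placeOfPrime p).adicCompletion ℚ)]
    exact (Valuation.map_add _ _ _).trans_lt (max_lt hY h2)
  exact hxy.elim h1'.ne h2'.ne

/-- An unramified local character with value `(e / p)` at `p` is trivial on the values of the norm
form `x² - e y²`. -/
theorem localCharacter_eq_one_of_norm {ψ : Adelesˣ →ₜ* ℤˣ} {e : ℤ}
    (hunr : ∀ u : ((placeOfPrime p).adicCompletion ℚ)ˣ,
      Valued.v (u : (placeOfPrime p).adicCompletion ℚ) = 1 →
        localCharacter ψ (placeOfPrime p) u = 1)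
    (hp : ((localCharacter ψ (placeOfPrime p) (primeUniformizer p) : ℤˣ) : ℤ) = legendreSym p e)
    {u : ((placeOfPrime p).adicCompletion ℚ)ˣ} {x y : (placeOfPrime p).adicCompletion ℚ}
    (hu : (u : (placeOfPrime p).adicCompletion ℚ) = x ^ 2 - e * y ^ 2) :
    localCharacter ψ (placeOfPrime p) u = 1 := by
  -- If the value at `p` is `1`, the local character is trivial outright. If it is `-1`, then `e` is
  -- a nonresidue, and scaling `x` and `y` to a primitive pair multiplies `u` by a square and makes
  -- it a unit.
  rcases Int.units_eq_one_or (localCharacter ψ (placeOfPrime p) (primeUniformizer p)) with h | h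
  · obtain ⟨k, hk⟩ := exists_zpow_mul_valued_eq_one p u.ne_zero
    have := hunr (primeUniformizer p ^ k * u) hk
    rwa [map_mul, map_zpow, h, one_zpow, one_mul] at this
  · rw [h] at hp
    have he : legendreSym p e = -1 := hp.symm
    have hscale : ∀ k : ℤ, ((primeUniformizer p ^ k * primeUniformizer p ^ k * u :
        ((placeOfPrime p).adicCompletion ℚ)ˣ) : (placeOfPrime p).adicCompletion ℚ) =
        (((primeUniformizer p ^ k : ((placeOfPrime p).adicCompletion ℚ)ˣ) :
          (placeOfPrime p).adicCompletion ℚ) * x) ^ 2 -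
        e * (((primeUniformizer p ^ k : ((placeOfPrime p).adicCompletion ℚ)ˣ) :
          (placeOfPrime p).adicCompletion ℚ) * y) ^ 2 := by
      intro k
      rw [Units.val_mul, Units.val_mul, hu]
      ring
    suffices hs : ∃ k : ℤ, Valued.v ((primeUniformizer p ^ k * primeUniformizer p ^ k * u :
        ((placeOfPrime p).adicCompletion ℚ)ˣ) : (placeOfPrime p).adicCompletion ℚ) = 1 by
      obtain ⟨k, hk⟩ := hs
      have := hunr _ hk
      rwa [map_mul, map_mul, Int.units_mul_self, one_mul] at this
    rcases le_total (Valued.v x) (Valued.v y) with hxy | hxy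
    · have hy0 : y ≠ 0 := by
        rintro rfl
        rw [map_zero, le_zero_iff, Valuation.zero_iff] at hxy
        exact u.ne_zero (by rw [hu, hxy]; ring)
      obtain ⟨k, hk⟩ := exists_zpow_mul_valued_eq_one p hy0
      refine ⟨k, ?_⟩
      rw [hscale k]
      refine valued_sq_sub_mul_sq_eq_one he ?_ hk.le (Or.inr hk)
      rw [← hk, map_mul, map_mul]
      exact mul_le_mul_right hxy _
    · have hx0 : x ≠ 0 := by
        rintro rfl
        rw [map_zero, le_zero_iff, Valuation.zero_iff] at hxy
        exact u.ne_zero (by rw [hu, hxy]; ring)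
      obtain ⟨k, hk⟩ := exists_zpow_mul_valued_eq_one p hx0
      refine ⟨k, ?_⟩
      rw [hscale k]
      refine valued_sq_sub_mul_sq_eq_one he hk.le ?_ (Or.inl hk)
      rw [← hk, map_mul, map_mul]
      exact mul_le_mul_right hxy _

end prime

end TorusCharacter

/-! ### Triviality on norms -/

namespace TorusCharacter

open IsDedekindDomain Topology

/-- Integers `X`, `Y` in given residue classes such that `X² - e Y²` has the sign of a given nonzero
real value of the form. -/
theorem exists_modEq_sq_sub_mul_sq_pos (e X Y : ℤ) {n : ℕ} (hn : n ≠ 0) {x y r : ℝ}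
    (hr : r = x ^ 2 - e * y ^ 2) (hr0 : r ≠ 0) :
    ∃ s t : ℤ, 0 < (((X + n * s) ^ 2 - e * (Y + n * t) ^ 2 : ℤ) : ℝ) * r := by
  have hn1 : (1 : ℤ) ≤ n := by exact_mod_cast Nat.one_le_iff_ne_zero.mpr hn
  have large : ∀ Z B : ℤ, ∃ s : ℤ, B ≤ Z + n * s := by
    intro Z B
    refine ⟨|B - Z|, ?_⟩
    have h1 := le_abs_self (B - Z)
    have h2 : |B - Z| ≤ n * |B - Z| := le_mul_of_one_le_left (abs_nonneg _) hn1
    linarith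
  rcases lt_or_gt_of_ne hr0 with h | h
  · have he : 0 < e := by
      by_contra hle
      have h1 : (e : ℝ) ≤ 0 := by exact_mod_cast not_lt.mp hle
      have h2 : (e : ℝ) * y ^ 2 ≤ 0 := mul_nonpos_of_nonpos_of_nonneg h1 (sq_nonneg y)
      linarith [sq_nonneg x]
    obtain ⟨t, ht⟩ := large Y (X ^ 2 + 1)
    refine ⟨0, t, mul_pos_of_neg_of_neg ?_ h⟩
    have h1 : (X + n * 0) ^ 2 - e * (Y + n * t) ^ 2 < 0 := by
      have h3 : 1 ≤ Y + n * t := by linarith [sq_nonneg X]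
      have h2 : Y + n * t ≤ e * (Y + n * t) ^ 2 :=
        calc Y + n * t ≤ (Y + n * t) ^ 2 := by nlinarith
          _ ≤ e * (Y + n * t) ^ 2 := le_mul_of_one_le_left (sq_nonneg _) he
      rw [mul_zero, add_zero]
      linarith
    exact_mod_cast h1
  · obtain ⟨s, hs⟩ := large X (|e| * Y ^ 2 + 1)
    refine ⟨s, 0, mul_pos ?_ h⟩
    have h1 : 0 < (X + n * s) ^ 2 - e * (Y + n * 0) ^ 2 := by
      have h4 : 0 ≤ |e| * Y ^ 2 := by positivity
      have h3 : 1 ≤ X + n * s := by linarith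
      have h2 : X + n * s ≤ (X + n * s) ^ 2 := by nlinarith
      have h5 : e * Y ^ 2 ≤ |e| * Y ^ 2 :=
        mul_le_mul_of_nonneg_right (le_abs_self e) (sq_nonneg _)
      rw [mul_zero, add_zero]
      linarith
    exact_mod_cast h1

/-- At all primes `p` not dividing `M`, the idele character `ψ` is unramified with value `(e / p)`
at `p`. -/
def HasLegendreValues (ψ : Adelesˣ →ₜ* ℤˣ) (e : ℤ) (M : ℕ) : Prop :=
  ∀ (p : ℕ) [Fact p.Prime], ¬ p ∣ M →
    (∀ u : ((placeOfPrime p).adicCompletion ℚ)ˣ,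
      Valued.v (u : (placeOfPrime p).adicCompletion ℚ) = 1 →
        localCharacter ψ (placeOfPrime p) u = 1) ∧
    ((localCharacter ψ (placeOfPrime p) (primeUniformizer p) : ℤˣ) : ℤ) = legendreSym p e

theorem valued_natCast_le_of_dvd (v : FinitePlace) {m n : ℕ} (h : m ∣ n) :
    Valued.v (n : v.adicCompletion ℚ) ≤ Valued.v (m : v.adicCompletion ℚ) := by
  obtain ⟨k, rfl⟩ := h
  rw [Nat.cast_mul, map_mul]
  exact mul_le_of_le_one_right' (valued_natCast_le_one v k)

/-- Weak approximation replaces `u` by a rational number `m` that is a value of the same form. Since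
`ψ m = 1`, it suffices to kill `w = m u⁻¹`: it is positive and near `1` at the bad primes, and a
quotient of two local norms at the others. -/
theorem apply_eq_one_of_integral_norm {ψ : Adelesˣ →ₜ* ℤˣ} (hψ : ψ ∈ quadraticHeckeCharacters)
    {e : ℤ} {M : ℕ} (hM : M ≠ 0) (hval : HasLegendreValues ψ e M) {u : Adelesˣ} {x y : Adeles}
    (hu : (u : Adeles) = x ^ 2 - e * y ^ 2) (hx : ∀ v, Valued.v (finiteComponent v x) ≤ 1)
    (hy : ∀ v, Valued.v (finiteComponent v y) ≤ 1) : ψ u = 1 := by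
  obtain ⟨N, hN⟩ := exists_modulus ψ
  -- The precision `N * M * L` has three purposes: `N` is the modulus of `ψ`, `M` makes `w` a unit
  -- at the excluded primes, and `L` absorbs the loss on dividing by `u`, since `|L| ≤ |u|` at every
  -- finite place.
  obtain ⟨L, hL0, hL⟩ := exists_natCast_mul_le_one ((u⁻¹ : Adelesˣ) : Adeles)
  have hNML : N * M * L ≠ 0 := mul_ne_zero (mul_ne_zero hN.1 hM) hL0
  obtain ⟨X, hX⟩ := exists_int_forall_sub_le (fun v => finiteComponent v x) hx hNML
  obtain ⟨Y, hY⟩ := exists_int_forall_sub_le (fun v => finiteComponent v y) hy hNML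
  have hr : realComponent (u : Adeles) = realComponent x ^ 2 - e * realComponent y ^ 2 := by
    rw [hu]; simp
  have huv : ∀ v, finiteComponent v (u : Adeles) =
      finiteComponent v x ^ 2 - e * finiteComponent v y ^ 2 := by
    intro v; rw [hu]; simp
  have hr0 : realComponent (u : Adeles) ≠ 0 := (u.isUnit.map realComponent).ne_zero
  have hu0 : ∀ v, finiteComponent v (u : Adeles) ≠ 0 :=
    fun v => (u.isUnit.map (finiteComponent v)).ne_zero
  obtain ⟨s, t, hst⟩ := exists_modEq_sq_sub_mul_sq_pos e X Y hNML hr hr0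
  have adjust : ∀ (z : Adeles) (Z s : ℤ), (∀ v, Valued.v (finiteComponent v z - Z) ≤
      Valued.v ((N * M * L : ℕ) : v.adicCompletion ℚ)) → ∀ v : FinitePlace,
      Valued.v (finiteComponent v z - (Z + (N * M * L : ℕ) * s : ℤ)) ≤
      Valued.v ((N * M * L : ℕ) : v.adicCompletion ℚ) := by
    intro z Z s hZ v
    rw [Int.cast_add, ← sub_sub]
    refine (Valuation.map_sub _ _ _).trans (max_le (hZ v) ?_)
    rw [Int.cast_mul, map_mul, Int.cast_natCast]
    exact mul_le_of_le_one_right' (valued_intCast_le_one v s)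
  replace hX := adjust x X s hX
  replace hY := adjust y Y t hY
  set X' : ℤ := X + (N * M * L : ℕ) * s
  set Y' : ℤ := Y + (N * M * L : ℕ) * t
  have hm0 : X' ^ 2 - e * Y' ^ 2 ≠ 0 := fun h => by
    rw [h] at hst
    simp at hst
  have hclose : ∀ v, Valued.v (((X' ^ 2 - e * Y' ^ 2 : ℤ) : v.adicCompletion ℚ) -
      finiteComponent v (u : Adeles)) ≤ Valued.v ((N * M * L : ℕ) : v.adicCompletion ℚ) := by
    intro v
    have h : ((X' ^ 2 - e * Y' ^ 2 : ℤ) : v.adicCompletion ℚ) - finiteComponent v (u : Adeles) =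
        (e * (finiteComponent v y + Y')) * (finiteComponent v y - Y') -
          (finiteComponent v x - X') * (finiteComponent v x + X') := by
      rw [huv]; push_cast; ring
    rw [h]
    refine (Valuation.map_sub _ _ _).trans (max_le ?_ ?_)
    · rw [map_mul, map_mul]
      exact (mul_le_of_le_one_left' (mul_le_one' (valued_intCast_le_one _ _)
        ((Valuation.map_add _ _ _).trans (max_le (hy v) (valued_intCast_le_one _ _))))).trans (hY v)
    · rw [map_mul]
      exact (mul_le_of_le_one_right' ((Valuation.map_add _ _ _).trans
        (max_le (hx v) (valued_intCast_le_one _ _)))).trans (hX v)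
  set m : ℚˣ := Units.mk0 ((X' ^ 2 - e * Y' ^ 2 : ℤ) : ℚ) (Int.cast_ne_zero.mpr hm0) with hm
  set w : Adelesˣ := principalIdele m * u⁻¹ with hw
  have hwu : (w : Adeles) * u = algebraMap ℚ Adeles ((X' ^ 2 - e * Y' ^ 2 : ℤ) : ℚ) := by
    rw [hw, Units.val_mul, Units.inv_mul_cancel_right]
    rfl
  have hwr : 0 < realComponent (w : Adeles) := by
    have h := congrArg realComponent hwu
    rw [map_mul, realComponent_algebraMap, Rat.cast_intCast] at h
    rw [← h, mul_assoc] at hst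
    exact pos_of_mul_pos_left hst (mul_self_nonneg _)
  have hwv : ∀ v, finiteComponent v (w : Adeles) * finiteComponent v (u : Adeles) =
      ((X' ^ 2 - e * Y' ^ 2 : ℤ) : v.adicCompletion ℚ) := by
    intro v
    have h := congrArg (finiteComponent v) hwu
    rwa [map_mul, finiteComponent_algebraMap, map_intCast] at h
  have hLu : ∀ v, Valued.v (L : v.adicCompletion ℚ) ≤ Valued.v (finiteComponent v (u : Adeles)) := by
    intro v
    have h := hL v
    have h1 : finiteComponent v ((u⁻¹ : Adelesˣ) : Adeles) * finiteComponent v (u : Adeles) = 1 := by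
      rw [← map_mul, Units.inv_mul, map_one]
    calc Valued.v (L : v.adicCompletion ℚ)
        = Valued.v (L * finiteComponent v ((u⁻¹ : Adelesˣ) : Adeles)) *
          Valued.v (finiteComponent v (u : Adeles)) := by rw [← map_mul, mul_assoc, h1, mul_one]
      _ ≤ _ := mul_le_of_le_one_left' h
  have hw1 : ∀ v, Valued.v (finiteComponent v (w : Adeles) - 1) ≤
      Valued.v ((N * M : ℕ) : v.adicCompletion ℚ) := by
    intro v
    have h0 : 0 < Valued.v (finiteComponent v (u : Adeles)) :=
      zero_lt_iff.mpr ((Valuation.ne_zero_iff _).mpr (hu0 v))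
    refine le_of_mul_le_mul_right ?_ h0
    rw [← map_mul, sub_mul, one_mul, hwv]
    refine (hclose v).trans ?_
    rw [Nat.cast_mul, map_mul]
    exact mul_le_mul_right (hLu v) _
  have hfin := eventually_valued_eq_one w
  have hψw : ψ w = 1 := by
    rw [hN.apply_eq_prod hfin.toFinset hwr fun v hv => ⟨by simpa using hfin.mem_toFinset.not.mp hv,
      (hw1 v).trans (valued_natCast_le_of_dvd v (dvd_mul_right N M))⟩]
    refine Finset.prod_eq_one fun v hv => ?_
    have hv1 : Valued.v (finiteComponent v (w : Adeles)) ≠ 1 := hfin.mem_toFinset.mp hv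
    obtain ⟨p, hp, rfl⟩ := exists_eq_placeOfPrime v
    -- At a prime dividing `N * M` the congruence makes `w` a unit, so the places that remain are
    -- all good ones.
    have hpNM : ¬ p ∣ N * M := by
      intro hdvd
      refine hv1 ?_
      have hlt : Valued.v (finiteComponent (placeOfPrime p) (w : Adeles) - 1) < 1 :=
        (hw1 _).trans_lt ((valued_natCast_lt_one_iff p _).mpr hdvd)
      have := Valuation.map_one_add_of_lt _ hlt
      rwa [add_sub_cancel] at this
    obtain ⟨h1, h2⟩ := hval p fun h => hpNM (h.mul_left N)
    have hum : localCharacter ψ (placeOfPrime p) (ideleComponent _ u) = 1 :=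
      localCharacter_eq_one_of_norm h1 h2 (huv _)
    have hmm : localCharacter ψ (placeOfPrime p) (ideleComponent _ (principalIdele m)) = 1 := by
      refine localCharacter_eq_one_of_norm (e := e) (x := X') (y := Y') h1 h2 ?_
      rw [ideleComponent_principalIdele, hm, Units.val_mk0, map_intCast]
      push_cast
      rfl
    rw [← localCharacter_apply, hw, map_mul, map_mul, map_inv, map_inv, hum, hmm, inv_one, mul_one]
  rw [hw, map_mul, hψ m, one_mul, map_inv, inv_eq_one] at hψw
  exact hψw

/-- A quadratic Hecke character with values `(e / p)` at almost all primes is trivial on the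
ideles of the form `x² - e y²`. -/
theorem apply_eq_one_of_norm {ψ : Adelesˣ →ₜ* ℤˣ} (hψ : ψ ∈ quadraticHeckeCharacters)
    {e : ℤ} {M : ℕ} (hM : M ≠ 0) (hval : HasLegendreValues ψ e M) {u : Adelesˣ} {x y : Adeles}
    (hu : (u : Adeles) = x ^ 2 - e * y ^ 2) : ψ u = 1 := by
  obtain ⟨D, hD0, hD⟩ := exists_natCast_mul_le_one x
  obtain ⟨E, hE0, hE⟩ := exists_natCast_mul_le_one y
  -- Clearing the denominators of `x` and `y` multiplies `u` by the square of `D * E`, which does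
  -- not affect `ψ`.
  set q : ℚˣ := Units.mk0 ((D * E : ℕ) : ℚ) (Nat.cast_ne_zero.mpr (mul_ne_zero hD0 hE0)) with hq
  have hqa : (principalIdele q : Adeles) = ((D * E : ℕ) : Adeles) :=
    map_natCast (algebraMap ℚ Adeles) (D * E)
  have h := apply_eq_one_of_integral_norm hψ hM hval (u := principalIdele q * principalIdele q * u)
    (x := ((D * E : ℕ) : Adeles) * x) (y := ((D * E : ℕ) : Adeles) * y) ?_ ?_ ?_
  · rwa [map_mul, map_mul, Int.units_mul_self, one_mul] at h
  · rw [Units.val_mul, Units.val_mul, hqa, hu]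
    ring
  · intro v
    rw [map_mul, map_natCast, Nat.cast_mul, mul_comm (D : v.adicCompletion ℚ), mul_assoc, map_mul]
    exact mul_le_one' (valued_natCast_le_one v E) (hD v)
  · intro v
    rw [map_mul, map_natCast, Nat.cast_mul, mul_assoc, map_mul]
    exact mul_le_one' (valued_natCast_le_one v D) (hE v)

/-- A quadratic Hecke character that is trivial at almost all primes is trivial. -/
theorem eq_one_of_hasLegendreValues_one {ψ : Adelesˣ →ₜ* ℤˣ} (hψ : ψ ∈ quadraticHeckeCharacters)
    {M : ℕ} (hM : M ≠ 0) (hval : HasLegendreValues ψ 1 M) : ψ = 1 := by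
  refine ContinuousMonoidHom.ext fun u => ?_
  have h2 : algebraMap ℚ Adeles (1 / 2) * 2 = 1 := by
    rw [← map_ofNat (algebraMap ℚ Adeles) 2, ← map_mul]
    norm_num
  -- For `e = 1` the form is split and represents every idele: `u = ((u+1)/2)² - ((u-1)/2)²`.
  refine apply_eq_one_of_norm hψ hM hval (x := algebraMap ℚ Adeles (1 / 2) * (u + 1))
    (y := algebraMap ℚ Adeles (1 / 2) * (u - 1)) ?_
  push_cast
  linear_combination (-(algebraMap ℚ Adeles (1 / 2) * 2) - 1) * (u : Adeles) * h2

theorem CorrespondsToLegendreSymbol.hasLegendreValues {ψ : Adelesˣ →ₜ* ℤˣ} {d : ℤ}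
    (h : CorrespondsToLegendreSymbol ψ d) : HasLegendreValues ψ d (2 * d.natAbs) := by
  intro p hp hpd
  refine h.2.2 p (fun h2 => hpd (h2 ▸ dvd_mul_right _ _)) fun hd => hpd ?_
  exact (Int.natCast_dvd.mp hd).mul_left 2

end TorusCharacter

/-! ### Classification of quadratic Hecke characters -/

namespace TorusCharacter

open IsDedekindDomain Topology
open scoped NumberTheorySymbols
open ZMod (χ₄ χ₈ χ₈')

theorem IsModulus.localCharacter_congr {ψ : Adelesˣ →ₜ* ℤˣ} {N : ℕ} (hN : IsModulus ψ N)
    {v : FinitePlace} {x y : (v.adicCompletion ℚ)ˣ} (hx : Valued.v (x : v.adicCompletion ℚ) = 1)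
    (hy : Valued.v (y : v.adicCompletion ℚ) = 1)
    (hxy : Valued.v ((x : v.adicCompletion ℚ) - y) ≤ Valued.v (N : v.adicCompletion ℚ)) :
    localCharacter ψ v x = localCharacter ψ v y := by
  have h : localCharacter ψ v (x * y⁻¹) = 1 := by
    refine hN.localCharacter_eq_one ?_ ?_
    · rw [Units.val_mul, map_mul, hx, Units.val_inv_eq_inv_val, map_inv₀, hy, inv_one, one_mul]
    · have h1 : ((x * y⁻¹ : (v.adicCompletion ℚ)ˣ) : v.adicCompletion ℚ) - 1 =
          (x - y) * (y : v.adicCompletion ℚ)⁻¹ := by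
        rw [Units.val_mul, Units.val_inv_eq_inv_val, sub_mul, mul_inv_cancel₀ y.ne_zero]
      rwa [h1, map_mul, map_inv₀, hy, inv_one, mul_one]
  rwa [map_mul, map_inv, mul_inv_eq_one] at h

open Classical in
/-- The local component of an idele character at a finite place, restricted to the integers and
extended by `0`. -/
noncomputable def intCharacter (ψ : Adelesˣ →ₜ* ℤˣ) (v : FinitePlace) : ℤ →* ℤ where
  toFun a := if h : a = 0 then 0 else
    ((localCharacter ψ v (ideleComponent v
      (principalIdele (Units.mk0 (a : ℚ) (Int.cast_ne_zero.mpr h)))) : ℤˣ) : ℤ)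
  map_one' := by
    have h : Units.mk0 ((1 : ℤ) : ℚ) (Int.cast_ne_zero.mpr one_ne_zero) = 1 :=
      Units.ext Int.cast_one
    rw [dif_neg one_ne_zero, h, map_one, map_one, map_one, Units.val_one]
  map_mul' a b := by
    by_cases ha : a = 0
    · simp [ha]
    by_cases hb : b = 0
    · simp [hb]
    have h : Units.mk0 ((a * b : ℤ) : ℚ) (Int.cast_ne_zero.mpr (mul_ne_zero ha hb)) =
        Units.mk0 (a : ℚ) (Int.cast_ne_zero.mpr ha) * Units.mk0 (b : ℚ) (Int.cast_ne_zero.mpr hb) :=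
      Units.ext (Int.cast_mul a b)
    rw [dif_neg ha, dif_neg hb, dif_neg (mul_ne_zero ha hb), h, map_mul, map_mul, map_mul,
      Units.val_mul]

theorem intCharacter_apply (ψ : Adelesˣ →ₜ* ℤˣ) (v : FinitePlace) {a : ℤ} (ha : a ≠ 0) :
    intCharacter ψ v a = ((localCharacter ψ v (ideleComponent v
      (principalIdele (Units.mk0 (a : ℚ) (Int.cast_ne_zero.mpr ha)))) : ℤˣ) : ℤ) :=
  dif_neg ha

theorem intCharacter_eq_one_or (ψ : Adelesˣ →ₜ* ℤˣ) (v : FinitePlace) {a : ℤ} (ha : a ≠ 0) :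
    intCharacter ψ v a = 1 ∨ intCharacter ψ v a = -1 := by
  rw [intCharacter_apply ψ v ha]
  rcases Int.units_eq_one_or (localCharacter ψ v (ideleComponent v
      (principalIdele (Units.mk0 (a : ℚ) (Int.cast_ne_zero.mpr ha))))) with h | h <;> simp [h]

theorem intCharacter_mul_self (ψ : Adelesˣ →ₜ* ℤˣ) (v : FinitePlace) {a : ℤ} (ha : a ≠ 0) :
    intCharacter ψ v (a * a) = 1 := by
  rw [map_mul]
  rcases intCharacter_eq_one_or ψ v ha with h | h <;> simp [h]

/-! ### Local components on integers prime to `p`. -/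

section prime

variable {ψ : Adelesˣ →ₜ* ℤˣ} {N : ℕ} (hN : IsModulus ψ N) {p : ℕ} [hp : Fact p.Prime]

include hN

theorem IsModulus.exists_intCharacter_congr : ∃ k : ℕ, ∀ a b : ℤ, ¬ (p : ℤ) ∣ a → ¬ (p : ℤ) ∣ b →
    (p : ℤ) ^ k ∣ a - b → intCharacter ψ (placeOfPrime p) a = intCharacter ψ (placeOfPrime p) b := by
  obtain ⟨k, hk⟩ := exists_pow_le_valued (placeOfPrime p) (natCast_adicCompletion_ne_zero _ hN.1)
  refine ⟨k, fun a b ha hb hab => ?_⟩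
  have ha0 : a ≠ 0 := fun h => ha (h ▸ dvd_zero _)
  have hb0 : b ≠ 0 := fun h => hb (h ▸ dvd_zero _)
  rw [intCharacter_apply _ _ ha0, intCharacter_apply _ _ hb0]
  congr 1
  refine hN.localCharacter_congr ?_ ?_ ?_
  · rw [ideleComponent_principalIdele, Units.val_mk0, map_intCast, valued_intCast_eq_one_iff]
    exact ha
  · rw [ideleComponent_principalIdele, Units.val_mk0, map_intCast, valued_intCast_eq_one_iff]
    exact hb
  · rw [ideleComponent_principalIdele, ideleComponent_principalIdele, Units.val_mk0, Units.val_mk0,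
      map_intCast, map_intCast, ← Int.cast_sub]
    exact ((valued_intCast_le_iff p k _).mpr hab).trans hk

/-- The local character is locally constant and integers prime to `p` are dense in the local units.
-/
theorem IsModulus.localCharacter_eq_one_of_intCharacter
    (h : ∀ a : ℤ, ¬ (p : ℤ) ∣ a → intCharacter ψ (placeOfPrime p) a = 1)
    {u : ((placeOfPrime p).adicCompletion ℚ)ˣ}
    (hu : Valued.v (u : (placeOfPrime p).adicCompletion ℚ) = 1) :
    localCharacter ψ (placeOfPrime p) u = 1 := by
  -- The extra factor `p` in the precision keeps `a` prime to `p` even when `p` does not divide `N`.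
  obtain ⟨a, ha⟩ := exists_intCast_sub_le _ hu.le (mul_ne_zero hp.out.ne_zero hN.1)
  have hap : Valued.v ((u : (placeOfPrime p).adicCompletion ℚ) - a) < 1 :=
    ha.trans_lt ((valued_natCast_lt_one_iff p _).mpr (dvd_mul_right p N))
  have ha1 : Valued.v (a : (placeOfPrime p).adicCompletion ℚ) = 1 := by
    rw [← hu]
    exact Valuation.map_eq_of_sub_lt _ (by rwa [Valuation.map_sub_swap, hu])
  have hpa := (valued_intCast_eq_one_iff p a).mp ha1
  have ha0 : a ≠ 0 := fun h => hpa (h ▸ dvd_zero _)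
  have h1 := h a hpa
  rw [intCharacter_apply _ _ ha0, Units.val_eq_one] at h1
  rw [← h1]
  refine hN.localCharacter_congr hu ?_ ?_
  · rw [ideleComponent_principalIdele, Units.val_mk0, map_intCast, ha1]
  · rw [ideleComponent_principalIdele, Units.val_mk0, map_intCast]
    exact ha.trans (valued_natCast_le_of_dvd _ (dvd_mul_left N p))

/-- Raising to the power `p ^ k` lifts a congruence modulo `p` to one modulo `p ^ (k + 1)`; as this
exponent is odd, it leaves signs unchanged. -/
theorem IsModulus.intCharacter_congr_of_odd (hp2 : p ≠ 2) {a b : ℤ} (ha : ¬ (p : ℤ) ∣ a)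
    (hb : ¬ (p : ℤ) ∣ b) (hab : (p : ℤ) ∣ a - b) :
    intCharacter ψ (placeOfPrime p) a = intCharacter ψ (placeOfPrime p) b := by
  obtain ⟨k, hk⟩ := hN.exists_intCharacter_congr (p := p)
  have hpp : Prime (p : ℤ) := Nat.prime_iff_prime_int.mp hp.out
  have h := hk (a ^ p ^ k) (b ^ p ^ k) (fun h => ha (hpp.dvd_of_dvd_pow h))
    (fun h => hb (hpp.dvd_of_dvd_pow h)) ((pow_dvd_pow _ k.le_succ).trans
      (dvd_sub_pow_of_dvd_sub hab k))
  have hodd : Odd (p ^ k) := (hp.out.odd_of_ne_two hp2).pow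
  have key : ∀ c : ℤ, ¬ (p : ℤ) ∣ c → intCharacter ψ (placeOfPrime p) (c ^ p ^ k) =
      intCharacter ψ (placeOfPrime p) c := by
    intro c hc
    rw [map_pow]
    rcases intCharacter_eq_one_or ψ (placeOfPrime p) (fun h => hc (h ▸ dvd_zero _) : c ≠ 0)
      with h | h <;> rw [h]
    · exact one_pow _
    · exact hodd.neg_one_pow
  rwa [key a ha, key b hb] at h

theorem IsModulus.intCharacter_eq_one_of_legendreSym (hp2 : p ≠ 2) {a : ℤ}
    (ha : legendreSym p a = 1) : intCharacter ψ (placeOfPrime p) a = 1 := by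
  have ha0 : (a : ZMod p) ≠ 0 := fun h => by
    rw [(legendreSym.eq_zero_iff p a).mpr h] at ha
    exact zero_ne_one ha
  obtain ⟨b, hb⟩ := (legendreSym.eq_one_iff p ha0).mp ha
  obtain ⟨b, rfl⟩ := ZMod.intCast_surjective b
  rw [← Int.cast_mul] at hb
  have hpb : ¬ (p : ℤ) ∣ b * b := by
    rwa [← ZMod.intCast_zmod_eq_zero_iff_dvd, ← hb]
  have hb0 : b ≠ 0 := fun h => hpb (by rw [h, mul_zero]; exact dvd_zero _)
  rw [hN.intCharacter_congr_of_odd hp2 (by rwa [← ZMod.intCast_zmod_eq_zero_iff_dvd]) hpb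
    ((ZMod.intCast_eq_intCast_iff_dvd_sub _ _ _).mp hb.symm), intCharacter_mul_self _ _ hb0]

/-- The local component at an odd prime is trivial on units or given by the Legendre symbol. -/
theorem IsModulus.intCharacter_eq_one_or_eq_legendreSym (hp2 : p ≠ 2) :
    (∀ a : ℤ, ¬ (p : ℤ) ∣ a → intCharacter ψ (placeOfPrime p) a = 1) ∨
    ∀ a : ℤ, ¬ (p : ℤ) ∣ a → intCharacter ψ (placeOfPrime p) a = legendreSym p a := by
  have hleg : ∀ a : ℤ, ¬ (p : ℤ) ∣ a → legendreSym p a = 1 ∨ legendreSym p a = -1 := fun a ha =>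
    legendreSym.eq_one_or_neg_one p (by rwa [Ne, ZMod.intCast_zmod_eq_zero_iff_dvd])
  refine or_iff_not_imp_left.mpr fun h a ha => ?_
  push Not at h
  obtain ⟨b, hb, hb1⟩ := h
  have hb2 := (hleg b hb).resolve_left
    fun h => hb1 (hN.intCharacter_eq_one_of_legendreSym hp2 h)
  have hb3 := (intCharacter_eq_one_or ψ (placeOfPrime p)
    (fun h => hb (h ▸ dvd_zero _) : b ≠ 0)).resolve_left hb1
  rcases hleg a ha with h | h
  · rw [h, hN.intCharacter_eq_one_of_legendreSym hp2 h]
  -- The product of the two nonresidues `a` and `b` is a residue, so `a` takes the same value `-1`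
  -- as `b`.
  · have h1 := hN.intCharacter_eq_one_of_legendreSym (a := a * b) hp2
      (by rw [legendreSym.mul, h, hb2]; norm_num)
    rw [map_mul, hb3] at h1
    rw [h]
    linarith

end prime

/-- An integer congruent to `1` modulo `8` is a square modulo every power of `2`. -/
theorem exists_sq_sub_dvd_of_modEq_one {a : ℤ} (ha : (8 : ℤ) ∣ a - 1) (k : ℕ) :
    ∃ b : ℤ, ¬ (2 : ℤ) ∣ b ∧ (2 : ℤ) ^ (k + 3) ∣ a - b * b := by
  induction k with
  | zero => exact ⟨1, by norm_num, by simpa using ha⟩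
  | succ k ih =>
    obtain ⟨b, hb, m, hm⟩ := ih
    -- Hensel step: the correction changes `b²` by `2 ^ (k + 3) * b * m` up to a multiple of `2 ^ (k
    -- + 4)`, and `b` is odd.
    refine ⟨b + 2 ^ (k + 2) * m, fun h => hb ?_, ?_⟩
    · refine (Int.dvd_iff_dvd_of_dvd_add h).mpr ?_
      exact Dvd.dvd.mul_right (dvd_pow_self 2 (by omega)) m
    · obtain ⟨c, hc⟩ : Odd b := by rwa [← Int.not_even_iff_odd, even_iff_two_dvd]
      have : a = b * b + 2 ^ (k + 3) * m := by linarith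
      refine ⟨-(c * m) - 2 ^ k * m ^ 2, ?_⟩
      rw [this, hc]
      ring

/-! ### The local component at `2`. -/

section two

variable {ψ : Adelesˣ →ₜ* ℤˣ} {N : ℕ} (hN : IsModulus ψ N)

include hN

/-- Odd squares are `1` modulo `8`, so `a * b` is `1` modulo `8`, hence a square to any `2`-adic
precision. The character is `1` on it and agrees at `a` and `b`. -/
theorem IsModulus.intCharacter_two_congr {a b : ℤ} (ha : ¬ (2 : ℤ) ∣ a) (hb : ¬ (2 : ℤ) ∣ b)
    (hab : (8 : ℤ) ∣ a - b) :
    intCharacter ψ (placeOfPrime 2) a = intCharacter ψ (placeOfPrime 2) b := by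
  obtain ⟨k, hk⟩ := hN.exists_intCharacter_congr (p := 2)
  have h8 : (8 : ℤ) ∣ a * b - 1 := by
    obtain ⟨m, hm⟩ := hab
    have h2 : b % 8 = 1 ∨ b % 8 = 3 ∨ b % 8 = 5 ∨ b % 8 = 7 := by omega
    have h3 : (8 : ℤ) ∣ b * b - 1 := by
      rw [Int.dvd_iff_emod_eq_zero, Int.sub_emod, Int.mul_emod]
      rcases h2 with h | h | h | h <;> rw [h] <;> norm_num
    have h4 : a * b - 1 = 8 * (m * b) + (b * b - 1) := by
      rw [show a = b + 8 * m by linarith]; ring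
    rw [h4]
    exact dvd_add (dvd_mul_right _ _) h3
  obtain ⟨c, hc, hc'⟩ := exists_sq_sub_dvd_of_modEq_one h8 k
  have hc0 : c ≠ 0 := fun h => hc (h ▸ dvd_zero _)
  have hab1 : intCharacter ψ (placeOfPrime 2) (a * b) = 1 := by
    rw [hk (a * b) (c * c) (fun h => (Int.prime_two.dvd_or_dvd h).elim ha hb)
      (fun h => (Int.prime_two.dvd_or_dvd h).elim hc hc)
      ((pow_dvd_pow 2 (Nat.le_add_right k 3)).trans hc'), intCharacter_mul_self _ _ hc0]
  rw [map_mul] at hab1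
  rcases intCharacter_eq_one_or ψ (placeOfPrime 2) (fun h => hb (h ▸ dvd_zero _) : b ≠ 0)
    with h | h <;> rw [h] at hab1 ⊢ <;> linarith

/-- The local component at `2` on odd positive integers is one of the characters modulo `8`. -/
theorem IsModulus.exists_intCharacter_two_eq_jacobiSym :
    ∃ δ : ℤ, (δ = 1 ∨ δ = -1 ∨ δ = 2 ∨ δ = -2) ∧
      ∀ n : ℕ, Odd n → intCharacter ψ (placeOfPrime 2) n = J(δ | n) := by
  set c := intCharacter ψ (placeOfPrime 2) with hc
  have hmod : ∀ n : ℕ, Odd n → c n = c (n % 8 : ℕ) := by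
    intro n hn
    have := Nat.odd_iff.mp hn
    exact hN.intCharacter_two_congr (by omega) (by omega) (by omega)
  have h7 : c 7 = c 3 * c 5 := by
    rw [← map_mul]
    exact hN.intCharacter_two_congr (by omega) (by omega) (by norm_num)
  have hcases : ∀ n : ℕ, Odd n → n % 8 = 1 ∨ n % 8 = 3 ∨ n % 8 = 5 ∨ n % 8 = 7 := by
    intro n hn
    have := Nat.odd_iff.mp hn
    omega
  have key : ∀ δ : ℤ, (δ = 1 ∨ δ = -1 ∨ δ = 2 ∨ δ = -2) → c 3 = J(δ | 3) → c 5 = J(δ | 5) →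
      ∀ n : ℕ, Odd n → c n = J(δ | n) := by
    intro δ hδ h3 h5 n hn
    have hJ : J(δ | n) = J(δ | n % 8) := by
      have h8 : (n % 8) % 2 = 1 := by
        have := Nat.odd_iff.mp hn
        omega
      refine jacobiSym_eq_of_modEq hn (Nat.odd_iff.mpr h8) (M := 8) ?_ (Nat.mod_modEq n 8).symm
      rcases hδ with rfl | rfl | rfl | rfl <;> decide
    rw [hJ, hmod n hn]
    rcases hcases n hn with h | h | h | h <;> rw [h]
    · rw [Nat.cast_one, map_one, jacobiSym.one_right]
    · exact h3
    · exact h5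
    · refine h7.trans ?_
      rw [h3, h5]
      rcases hδ with rfl | rfl | rfl | rfl <;> norm_num
  -- The classes of `3` and `5` generate the units modulo `8`, so the four sign patterns there
  -- single out `δ`.
  rcases intCharacter_eq_one_or ψ (placeOfPrime 2) (by norm_num : (3 : ℤ) ≠ 0) with h3 | h3 <;>
    rcases intCharacter_eq_one_or ψ (placeOfPrime 2) (by norm_num : (5 : ℤ) ≠ 0) with h5 | h5
  · exact ⟨1, by simp, key 1 (by simp) (h3.trans (by norm_num)) (h5.trans (by norm_num))⟩
  · exact ⟨-2, by simp, key (-2) (by simp) (h3.trans (by norm_num)) (h5.trans (by norm_num))⟩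
  · exact ⟨-1, by simp, key (-1) (by simp) (h3.trans (by norm_num)) (h5.trans (by norm_num))⟩
  · exact ⟨2, by simp, key 2 (by simp) (h3.trans (by norm_num)) (h5.trans (by norm_num))⟩

end two

/-- Quadratic reciprocity with its sign absorbed into `q* = χ₄(q) q`; these signed primes become the
odd factors of `d`. -/
theorem legendreSym_eq_legendreSym_χ₄_mul {p q : ℕ} [hp : Fact p.Prime] [hq : Fact q.Prime]
    (hp2 : p ≠ 2) (hq2 : q ≠ 2) : legendreSym q p = legendreSym p (χ₄ q * q) := by
  have hpo := Nat.odd_iff.mp (hp.out.odd_of_ne_two hp2)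
  have hqo := Nat.odd_iff.mp (hq.out.odd_of_ne_two hq2)
  have hq4 : q % 4 = 1 ∨ q % 4 = 3 := by omega
  have hp4 : p % 4 = 1 ∨ p % 4 = 3 := by omega
  rcases hq4 with hq4 | hq4
  · rw [ZMod.χ₄_nat_one_mod_four hq4, one_mul,
      legendreSym.quadratic_reciprocity_one_mod_four hq4 hp2]
  · rw [ZMod.χ₄_nat_three_mod_four hq4, neg_one_mul, neg_eq_neg_one_mul (q : ℤ),
      legendreSym.mul, legendreSym.at_neg_one hp2]
    rcases hp4 with hp4 | hp4
    · rw [ZMod.χ₄_nat_one_mod_four hp4, one_mul,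
        legendreSym.quadratic_reciprocity_one_mod_four hp4 hq2]
    · rw [ZMod.χ₄_nat_three_mod_four hp4, neg_one_mul,
        legendreSym.quadratic_reciprocity_three_mod_four hp4 hq4]

end TorusCharacter

/-! ### The global character from its local components. -/

namespace TorusCharacter

open IsDedekindDomain Topology
open scoped NumberTheorySymbols
open ZMod (χ₄)

instance fact_prime_primes (q : Nat.Primes) : Fact (q : ℕ).Prime := ⟨q.2⟩

/-- The prime numbers dividing `n`. -/
def primesDividing (n : ℕ) : Finset Nat.Primes := n.primeFactors.subtype Nat.Prime

theorem mem_primesDividing {n : ℕ} (hn : n ≠ 0) {q : Nat.Primes} :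
    q ∈ primesDividing n ↔ (q : ℕ) ∣ n :=
  (Finset.mem_subtype).trans ⟨Nat.dvd_of_mem_primeFactors, fun h =>
    Nat.mem_primeFactors.mpr ⟨q.2, h, hn⟩⟩

/-- The product formula for the value of a Hecke character at a prime number. -/
theorem IsModulus.prod_intCharacter_eq_one {ψ : Adelesˣ →ₜ* ℤˣ} {N : ℕ} (hN : IsModulus ψ N)
    (hψ : ψ ∈ quadraticHeckeCharacters) {n : ℕ} (hn : n ≠ 0) :
    ∏ q ∈ primesDividing (N * n), intCharacter ψ (placeOfPrime q) n = 1 := by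
  classical
  have hn0 : ((n : ℤ) : ℚ) ≠ 0 := Int.cast_ne_zero.mpr (Nat.cast_ne_zero.mpr hn)
  have hinj : Function.Injective fun q : Nat.Primes => placeOfPrime q :=
    fun q r h => Subtype.ext (placeOfPrime_injective h)
  have h := hN.apply_eq_prod ((primesDividing (N * n)).image fun q : Nat.Primes => placeOfPrime q)
    (u := principalIdele (Units.mk0 _ hn0)) ?_ ?_
  · rw [hψ, Finset.prod_image hinj.injOn] at h
    have h1 := congrArg Units.val h
    rw [Units.coe_prod, Units.val_one] at h1
    rw [h1]
    exact Finset.prod_congr rfl fun q _ => intCharacter_apply _ _ (Nat.cast_ne_zero.mpr hn)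
  · change 0 < realComponent (algebraMap ℚ Adeles _)
    rw [realComponent_algebraMap, Units.val_mk0, Int.cast_natCast, Rat.cast_natCast]
    exact_mod_cast Nat.pos_of_ne_zero hn
  · intro v hv
    obtain ⟨q, hq, rfl⟩ := exists_eq_placeOfPrime v
    have hqn : ¬ q ∣ N * n := fun h => hv (Finset.mem_image.mpr
      ⟨⟨q, hq.out⟩, (mem_primesDividing (mul_ne_zero hN.1 hn)).mpr h, rfl⟩)
    have hunit : ∀ m : ℕ, ¬ q ∣ m → Valued.v (m : (placeOfPrime q).adicCompletion ℚ) = 1 :=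
      fun m hm => le_antisymm (valued_natCast_le_one _ m)
        (not_lt.mp ((valued_natCast_lt_one_iff q m).not.mpr hm))
    have h1 : finiteComponent (placeOfPrime q) (principalIdele (Units.mk0 _ hn0) : Adeles) = n := by
      refine (ideleComponent_principalIdele _ _).trans ?_
      rw [Units.val_mk0, Int.cast_natCast, map_natCast]
    rw [h1]
    have h2 := hunit n fun h => hqn (h.mul_left N)
    exact ⟨h2, valued_sub_one_le h2 (hunit N fun h => hqn (h.mul_right n))⟩

/-- The signed odd primes are pairwise non-associated primes, and `δ` has at most the simple prime
factor `2`. -/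
theorem squarefree_mul_prod_χ₄_mul {δ : ℤ} (hδ : δ = 1 ∨ δ = -1 ∨ δ = 2 ∨ δ = -2)
    (S : Finset Nat.Primes) (hS : ∀ q ∈ S, (q : ℕ) ≠ 2) :
    Squarefree (δ * ∏ q ∈ S, χ₄ (q : ℕ) * (q : ℕ)) := by
  have hassoc : ∀ q ∈ S, Associated (χ₄ (q : ℕ) * (q : ℕ) : ℤ) (q : ℕ) := by
    intro q hq
    have hqo := Nat.odd_iff.mp (q.2.odd_of_ne_two (hS q hq))
    have hq4 : (q : ℕ) % 4 = 1 ∨ (q : ℕ) % 4 = 3 := by omega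
    rcases hq4 with h | h
    · rw [ZMod.χ₄_nat_one_mod_four h, one_mul]
    · rw [ZMod.χ₄_nat_three_mod_four h, neg_one_mul]
      exact Associated.neg_left (Associated.refl _)
  have hprime : ∀ q ∈ S, Prime (χ₄ (q : ℕ) * (q : ℕ) : ℤ) := fun q hq =>
    (hassoc q hq).symm.prime (Nat.prime_iff_prime_int.mp q.2)
  rw [squarefree_mul_iff]
  refine ⟨?_, ?_, ?_⟩
  · refine IsRelPrime.prod_right fun q hq => ?_
    refine IsRelPrime.symm (((hprime q hq).irreducible.isRelPrime_iff_not_dvd).mpr fun h => ?_)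
    have h1 : ((q : ℕ) : ℤ) ∣ δ := (hassoc q hq).symm.dvd.trans h
    have h2 : (q : ℕ) ∣ 2 := by
      rcases hδ with rfl | rfl | rfl | rfl
      · exact_mod_cast h1.trans (one_dvd 2)
      · exact_mod_cast h1.trans (by norm_num : (-1 : ℤ) ∣ 2)
      · exact_mod_cast h1
      · exact_mod_cast h1.trans (by norm_num : (-2 : ℤ) ∣ 2)
    exact hS q hq ((Nat.prime_dvd_prime_iff_eq q.2 Nat.prime_two).mp h2)
  · rw [← Int.squarefree_natAbs]
    rcases hδ with rfl | rfl | rfl | rfl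
    · exact squarefree_one
    · exact squarefree_one
    · exact Nat.prime_two.prime.squarefree
    · exact Nat.prime_two.prime.squarefree
  · refine Finset.squarefree_prod_of_pairwise_isCoprime (fun q hq r hr hqr => ?_)
      fun q hq => (hprime q hq).squarefree
    refine ((hprime q hq).irreducible.isRelPrime_iff_not_dvd).mpr fun h => hqr ?_
    have h1 : ((q : ℕ) : ℤ) ∣ (r : ℕ) := (hassoc q hq).symm.dvd.trans (h.trans (hassoc r hr).dvd)
    exact Subtype.ext ((Nat.prime_dvd_prime_iff_eq q.2 r.2).mp (Int.natCast_dvd_natCast.mp h1))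

/-- Every quadratic Hecke character of `ℚ` is given by a Legendre symbol at almost all primes. -/
theorem exists_squarefree_hasLegendreValues {ψ : Adelesˣ →ₜ* ℤˣ}
    (hψ : ψ ∈ quadraticHeckeCharacters) :
    ∃ d : ℤ, Squarefree d ∧ HasLegendreValues ψ d (2 * d.natAbs) := by
  classical
  obtain ⟨N, hN⟩ := exists_modulus ψ
  obtain ⟨δ, hδ, hδ2⟩ := hN.exists_intCharacter_two_eq_jacobiSym
  set Unr : Nat.Primes → Prop := fun q =>
    ∀ a : ℤ, ¬ ((q : ℕ) : ℤ) ∣ a → intCharacter ψ (placeOfPrime q) a = 1 with hUnr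
  have hdvd : ∀ q : Nat.Primes, ¬ Unr q → (q : ℕ) ∣ N := by
    intro q hq
    by_contra hqN
    refine hq fun a ha => ?_
    rw [intCharacter_apply _ _ (fun h => ha (h ▸ dvd_zero _) : a ≠ 0), Units.val_eq_one]
    refine hN.localCharacter_eq_one_of_not_dvd hqN ?_
    rw [ideleComponent_principalIdele, Units.val_mk0, map_intCast]
    exact (valued_intCast_eq_one_iff q a).mpr ha
  set S : Finset Nat.Primes := (primesDividing N).filter fun q => (q : ℕ) ≠ 2 ∧ ¬ Unr q with hS
  have hmemS : ∀ q : Nat.Primes, q ∈ S ↔ (q : ℕ) ≠ 2 ∧ ¬ Unr q := fun q => by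
    rw [hS, Finset.mem_filter, mem_primesDividing hN.1]
    exact ⟨fun h => h.2, fun h => ⟨hdvd q h.2, h⟩⟩
  -- `S` consists of the odd ramified primes. Each contributes its signed prime, while `δ` records
  -- the behaviour at `2`.
  refine ⟨δ * ∏ q ∈ S, χ₄ (q : ℕ) * (q : ℕ), squarefree_mul_prod_χ₄_mul hδ S
    fun q hq => ((hmemS q).mp hq).1, fun p hp hpd => ?_⟩
  set d : ℤ := δ * ∏ q ∈ S, χ₄ (q : ℕ) * (q : ℕ) with hd
  have hp2 : p ≠ 2 := fun h => hpd (h ▸ dvd_mul_right _ _)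
  have hpo : Odd p := hp.out.odd_of_ne_two hp2
  set P : Nat.Primes := ⟨p, hp.out⟩ with hP
  have hPS : P ∉ S := fun h => hpd <| by
    refine (Int.natCast_dvd.mp ?_).mul_left 2
    rw [hd, ← Finset.mul_prod_erase S _ h]
    exact ((dvd_mul_left _ _).mul_right _).mul_left _
  have hunr : Unr P := by
    by_contra h
    exact hPS ((hmemS P).mpr ⟨hp2, h⟩)
  refine ⟨fun u hu => hN.localCharacter_eq_one_of_intCharacter hunr hu, ?_⟩
  have hp0 : (p : ℤ) ≠ 0 := Nat.cast_ne_zero.mpr hp.out.ne_zero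
  have huni : primeUniformizer p = ideleComponent (placeOfPrime p)
      (principalIdele (Units.mk0 ((p : ℤ) : ℚ) (Int.cast_ne_zero.mpr hp0))) := by
    ext
    rw [coe_primeUniformizer, ideleComponent_principalIdele, Units.val_mk0, Int.cast_natCast,
      map_natCast]
  rw [huni, ← intCharacter_apply ψ _ hp0]
  -- Enlarging the modulus makes `2` occur in the product formula even if `N` is odd.
  have hN2 : IsModulus ψ (N * 2) := ⟨mul_ne_zero hN.1 two_ne_zero, fun u hu hu' => hN.2 u hu
    fun v => ⟨(hu' v).1, (hu' v).2.trans (valued_natCast_le_of_dvd v (dvd_mul_right N 2))⟩⟩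
  have hprod := hN2.prod_intCharacter_eq_one hψ hp.out.ne_zero
  have hNp : N * 2 * p ≠ 0 := mul_ne_zero hN2.1 hp.out.ne_zero
  set P2 : Nat.Primes := ⟨2, Nat.prime_two⟩ with hP2
  have hPP2 : P ≠ P2 := fun h => hp2 (congrArg Subtype.val h)
  have hP2S : P2 ∉ S := fun h => ((hmemS P2).mp h).1 rfl
  -- The factors of the product formula at the rational number `p`: the wanted value at `p`, `(δ/p)`
  -- at `2`, `(p/q) = (q*/p)` on `S`, and `1` elsewhere.
  have hfactor : ∀ q ∈ primesDividing (N * 2 * p), intCharacter ψ (placeOfPrime q) p =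
      (if q = P then intCharacter ψ (placeOfPrime p) p else 1) * (if q = P2 then J(δ | p) else 1) *
        (if q ∈ S then legendreSym p (χ₄ (q : ℕ) * (q : ℕ)) else 1) := by
    intro q _
    by_cases hqP : q = P
    · subst hqP
      rw [if_pos rfl, if_neg hPP2, if_neg hPS, mul_one, mul_one]
    by_cases hqP2 : q = P2
    · subst hqP2
      rw [if_neg hqP, if_pos rfl, if_neg hP2S, mul_one, one_mul]
      exact hδ2 p hpo
    rw [if_neg hqP, if_neg hqP2, one_mul, one_mul]
    have hqp : ¬ ((q : ℕ) : ℤ) ∣ p := fun h => hqP (Subtype.ext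
      ((Nat.prime_dvd_prime_iff_eq q.2 hp.out).mp (Int.natCast_dvd_natCast.mp h)))
    have hq2 : (q : ℕ) ≠ 2 := fun h => hqP2 (Subtype.ext h)
    split_ifs with hqS
    · rw [← legendreSym_eq_legendreSym_χ₄_mul hp2 hq2]
      exact (hN.intCharacter_eq_one_or_eq_legendreSym hq2).resolve_left ((hmemS q).mp hqS).2 p hqp
    · by_contra h
      exact hqS ((hmemS q).mpr ⟨hq2, fun h' => h (h' p hqp)⟩)
  have hST : S ⊆ primesDividing (N * 2 * p) := fun q hq => by
    rw [mem_primesDividing hNp, mul_assoc]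
    exact (hdvd q ((hmemS q).mp hq).2).mul_right _
  have hPT : P ∈ primesDividing (N * 2 * p) := (mem_primesDividing hNp).mpr (dvd_mul_left p _)
  have hP2T : P2 ∈ primesDividing (N * 2 * p) :=
    (mem_primesDividing hNp).mpr ((dvd_mul_left 2 N).mul_right p)
  rw [Finset.prod_congr rfl hfactor, Finset.prod_mul_distrib, Finset.prod_mul_distrib,
    Finset.prod_ite_eq', Finset.prod_ite_eq', if_pos hPT, if_pos hP2T, Finset.prod_ite_mem,
    Finset.inter_eq_right.mpr hST, mul_assoc, ← jacobiSym.legendreSym.to_jacobiSym] at hprod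
  have hleg : legendreSym p d =
      legendreSym p δ * ∏ q ∈ S, legendreSym p (χ₄ (q : ℕ) * (q : ℕ)) := by
    rw [hd, legendreSym.mul]
    congr 1
    exact map_prod (legendreSym.hom p) _ S
  rw [← hleg] at hprod
  -- The product of the value at `p` and `(d/p)` is `1`, and the first is a sign, so the two agree.
  rcases intCharacter_eq_one_or ψ (placeOfPrime p) hp0 with h | h <;> rw [h] at hprod ⊢ <;> linarith

/-- A nontrivial quadratic Hecke character of `ℚ` corresponds to a unique Legendre symbol. -/
theorem existsUnique_correspondsToLegendreSymbol {ψ : Adelesˣ →ₜ* ℤˣ}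
    (hψ : ψ ∈ quadraticHeckeCharacters) (hψ1 : ψ ≠ 1) :
    ∃! d : ℤ, CorrespondsToLegendreSymbol ψ d := by
  obtain ⟨d, hd, hval⟩ := exists_squarefree_hasLegendreValues hψ
  have hd1 : d ≠ 1 := by
    rintro rfl
    exact hψ1 (eq_one_of_hasLegendreValues_one hψ (by norm_num) hval)
  have hcorr : CorrespondsToLegendreSymbol ψ d := by
    refine ⟨hd, hd1, fun p hp hp2 hpd => hval p fun h => ?_⟩
    exact (hp.out.dvd_mul.mp h).elim
      (fun h => hp2 ((Nat.prime_dvd_prime_iff_eq hp.out Nat.prime_two).mp h))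
      fun h => hpd (Int.natCast_dvd.mpr h)
  refine ⟨d, hcorr, fun d' hd' => ?_⟩
  by_contra hne
  -- A prime at which `d'` is inert and `d` splits, large enough to be good for both, would force
  -- two different values of `ψ`.
  obtain ⟨p, hp, hpp, -, h1, h2⟩ := exists_prime_legendreSym hd'.1 hd'.2.1 hd hne
    (2 * d.natAbs * (2 * d'.natAbs))
  have := Fact.mk hpp
  have hbig : ¬ p ∣ 2 * d.natAbs * (2 * d'.natAbs) := Nat.not_dvd_of_pos_of_lt
    (Nat.pos_of_ne_zero (mul_ne_zero (mul_ne_zero two_ne_zero (Int.natAbs_ne_zero.mpr hd.ne_zero))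
      (mul_ne_zero two_ne_zero (Int.natAbs_ne_zero.mpr hd'.1.ne_zero)))) hp
  have h3 := (hcorr.hasLegendreValues p fun h => hbig (h.mul_right _)).2
  have h4 := (hd'.hasLegendreValues p fun h => hbig (h.mul_left _)).2
  rw [jacobiSym.legendreSym.to_jacobiSym] at h3 h4
  rw [h3, h2, h1] at h4
  norm_num at h4

end TorusCharacter

/-! ### Quadratic fields -/

namespace TorusCharacter

open IsDedekindDomain Topology

variable {K : Type*} [Field K] [NumberField K]

theorem not_isSquare_of_squarefree {e : ℤ} (he : Squarefree e) (he1 : e ≠ 1) (r : ℚ) :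
    r * r ≠ e := by
  intro h
  obtain ⟨n, hn⟩ := (Rat.isSquare_intCast_iff).mp ⟨r, h.symm⟩
  have hu := he n ⟨1, by rw [hn, mul_one]⟩
  exact he1 (by rw [hn]; exact Int.isUnit_mul_self hu)

theorem ne_algebraMap_of_mul_self {e : ℤ} (he : Squarefree e) (he1 : e ≠ 1) {θ : K}
    (hθ : θ * θ = e) (r : ℚ) : θ ≠ algebraMap ℚ K r := by
  rintro rfl
  rw [← map_mul, ← map_intCast (algebraMap ℚ K)] at hθ
  exact not_isSquare_of_squarefree he he1 r ((algebraMap ℚ K).injective hθ)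

/-- In a quadratic field, every irrational element generates the field additively over `ℚ`
together with `1`. -/
theorem exists_eq_add_mul (hK : Module.finrank ℚ K = 2) {θ : K}
    (hθ : ∀ r : ℚ, θ ≠ algebraMap ℚ K r) (z : K) :
    ∃ r s : ℚ, z = algebraMap ℚ K r + algebraMap ℚ K s * θ := by
  have hli : LinearIndependent ℚ ![(1 : K), θ] := by
    rw [LinearIndependent.pair_iff]
    intro s t hst
    rw [Algebra.smul_def, Algebra.smul_def, mul_one] at hst
    have ht : t = 0 := by
      by_contra ht
      refine hθ (-(s / t)) ?_
      have ht' : algebraMap ℚ K t ≠ 0 := (map_ne_zero _).mpr ht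
      rw [map_neg, map_div₀, eq_neg_iff_add_eq_zero]
      field_simp
      linear_combination hst
    rw [ht, map_zero, zero_mul, add_zero, map_eq_zero] at hst
    exact ⟨hst, ht⟩
  have hspan := hli.span_eq_top_of_card_eq_finrank' (by simp [hK])
  have hz : z ∈ Submodule.span ℚ (Set.range ![(1 : K), θ]) := hspan ▸ Submodule.mem_top
  rw [Matrix.range_cons, Matrix.range_cons, Matrix.range_empty, Set.union_empty,
    Set.singleton_union, Submodule.mem_span_pair] at hz
  obtain ⟨r, s, h⟩ := hz
  exact ⟨r, s, by rw [← h, Algebra.smul_def, Algebra.smul_def, mul_one]⟩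

theorem exists_squarefree_eq_mul_sq {q : ℚ} (hq : q ≠ 0) :
    ∃ (e : ℤ) (r : ℚ), Squarefree e ∧ r ≠ 0 ∧ q * (r * r) = e := by
  have hm : q.num * q.den ≠ 0 :=
    mul_ne_zero (Rat.num_ne_zero.mpr hq) (Nat.cast_ne_zero.mpr q.den_nz)
  -- Multiplying `q` by the square of its denominator gives the integer `num * den`; its square part
  -- `b²` is then divided out, whence `r = den / b`.
  obtain ⟨a, b, hab, ha⟩ := Nat.sq_mul_squarefree (q.num * q.den).natAbs
  have hb0 : b ≠ 0 := by
    rintro rfl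
    rw [zero_pow two_ne_zero, zero_mul] at hab
    exact hm (Int.natAbs_eq_zero.mp hab.symm)
  have hbq : (b : ℚ) ≠ 0 := Nat.cast_ne_zero.mpr hb0
  have hdq : (q.den : ℚ) ≠ 0 := Nat.cast_ne_zero.mpr q.den_nz
  have hab' : (b : ℚ) ^ 2 * a = ((q.num * q.den).natAbs : ℚ) := by exact_mod_cast hab
  have hqd : q * q.den = q.num := Rat.mul_den_eq_num q
  rcases Int.natAbs_eq (q.num * q.den) with h | h
  · refine ⟨a, q.den / b, Int.squarefree_natCast.mpr ha, div_ne_zero hdq hbq, ?_⟩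
    have h' : (q.num : ℚ) * q.den = ((q.num * q.den).natAbs : ℚ) := by
      simpa only [Int.cast_mul, Int.cast_natCast, Int.cast_neg] using
        congrArg (Int.cast : ℤ → ℚ) h
    rw [← hab', ← hqd] at h'
    rw [Int.cast_natCast]
    field_simp
    linear_combination h'
  · refine ⟨-a, q.den / b, Int.squarefree_natAbs.mp
      (by rwa [Int.natAbs_neg, Int.natAbs_natCast]), div_ne_zero hdq hbq, ?_⟩
    have h' : (q.num : ℚ) * q.den = -((q.num * q.den).natAbs : ℚ) := by
      simpa only [Int.cast_mul, Int.cast_natCast, Int.cast_neg] using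
        congrArg (Int.cast : ℤ → ℚ) h
    rw [← hab', ← hqd] at h'
    rw [Int.cast_neg, Int.cast_natCast]
    field_simp
    linear_combination h'

/-- A quadratic field is generated by the square root of a squarefree integer. -/
theorem exists_squarefree_sqrt (hK : Module.finrank ℚ K = 2) :
    ∃ (e : ℤ) (θ : K), Squarefree e ∧ e ≠ 1 ∧ θ * θ = e := by
  obtain ⟨x, hx⟩ : ∃ x : K, ∀ r : ℚ, x ≠ algebraMap ℚ K r := by
    by_contra! h
    have : (⊥ : Subalgebra ℚ K) = ⊤ := by
      refine eq_top_iff.mpr fun x _ => ?_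
      obtain ⟨r, hr⟩ := h x
      exact Algebra.mem_bot.mpr ⟨r, hr.symm⟩
    have h1 := Subalgebra.bot_eq_top_iff_finrank_eq_one.mp this
    omega
  obtain ⟨r, s, hrs⟩ := exists_eq_add_mul hK hx (x * x)
  have h4 : (algebraMap ℚ K 2)  = 2 := map_ofNat _ 2
  -- Completing the square in `x² = r + s x`.
  have hsq : (x - algebraMap ℚ K (s / 2)) * (x - algebraMap ℚ K (s / 2)) =
      algebraMap ℚ K (r + s ^ 2 / 4) := by
    have h2 : algebraMap ℚ K s = 2 * algebraMap ℚ K (s / 2) := by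
      rw [← h4, ← map_mul]
      congr 1
      ring
    have h3 : algebraMap ℚ K (r + s ^ 2 / 4) =
        algebraMap ℚ K r + algebraMap ℚ K (s / 2) * algebraMap ℚ K (s / 2) := by
      rw [← map_mul, ← map_add]
      congr 1
      ring
    rw [h3]
    rw [h2] at hrs
    linear_combination hrs
  have hq0 : r + s ^ 2 / 4 ≠ 0 := by
    intro h
    rw [h, map_zero, mul_self_eq_zero, sub_eq_zero] at hsq
    exact hx _ hsq
  obtain ⟨e, t, he, ht, het⟩ := exists_squarefree_eq_mul_sq hq0
  refine ⟨e, (x - algebraMap ℚ K (s / 2)) * algebraMap ℚ K t, he, ?_, ?_⟩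
  -- With `e = 1` the square root would be `±1`, which would make `x` rational.
  · rintro rfl
    have h1 : ((x - algebraMap ℚ K (s / 2)) * algebraMap ℚ K t) *
        ((x - algebraMap ℚ K (s / 2)) * algebraMap ℚ K t) = 1 := by
      rw [mul_mul_mul_comm, hsq, ← map_mul, ← map_mul, het]
      simp
    have ht' : algebraMap ℚ K t ≠ 0 := (map_ne_zero _).mpr ht
    rcases mul_self_eq_one_iff.mp h1 with h | h
    · refine hx (s / 2 + t⁻¹) ?_
      rw [map_add, map_inv₀]
      field_simp
      linear_combination h
    · refine hx (s / 2 - t⁻¹) ?_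
      rw [map_sub, map_inv₀]
      field_simp
      linear_combination h
  · rw [mul_mul_mul_comm, hsq, ← map_mul, ← map_mul, het, map_intCast]

theorem nonempty_algEquiv_quadraticAlgebra (hK : Module.finrank ℚ K = 2) {e : ℤ}
    (he : Squarefree e) (he1 : e ≠ 1) {θ : K} (hθ : θ * θ = e) :
    Nonempty (K ≃ₐ[ℚ] QuadraticAlgebra ℚ (e : ℚ) 0) := by
  have hθ' := ne_algebraMap_of_mul_self he he1 hθ
  let f : QuadraticAlgebra ℚ (e : ℚ) 0 →ₐ[ℚ] K := QuadraticAlgebra.lift ⟨θ, by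
    rw [hθ, zero_smul, add_zero, Algebra.smul_def, mul_one, map_intCast]⟩
  have hf : ∀ z, f z = algebraMap ℚ K z.re + algebraMap ℚ K z.im * θ := fun z => by
    change z.re • (1 : K) + z.im • θ = _
    rw [Algebra.smul_def, Algebra.smul_def, mul_one]
  refine ⟨(AlgEquiv.ofBijective f ⟨?_, fun z => ?_⟩).symm⟩
  · rw [injective_iff_map_eq_zero]
    intro z hz
    rw [hf] at hz
    have him : z.im = 0 := by
      by_contra h
      refine hθ' (-(z.re / z.im)) ?_
      have h' : algebraMap ℚ K z.im ≠ 0 := (map_ne_zero _).mpr h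
      rw [map_neg, map_div₀, eq_neg_iff_add_eq_zero]
      field_simp
      linear_combination hz
    rw [him, map_zero, zero_mul, add_zero, map_eq_zero] at hz
    exact QuadraticAlgebra.ext hz him
  · obtain ⟨r, s, h⟩ := exists_eq_add_mul hK hθ' z
    exact ⟨⟨r, s⟩, by rw [hf, h]⟩

/-! ### The norm on the torus -/

/-- The square root of a nonsquare in a quaternion algebra is a pure quaternion. -/
theorem pure_of_mul_self {a b : ℚ} {β : ℍ[ℚ,a,b]} {e : ℤ} (he : ∀ r : ℚ, r * r ≠ e)
    (hβ : β * β = e) :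
    β.re = 0 ∧ a * β.imI ^ 2 + b * β.imJ ^ 2 - a * b * β.imK ^ 2 = e := by
  have h0 := congrArg QuaternionAlgebra.re hβ
  have h1 := congrArg QuaternionAlgebra.imI hβ
  have h2 := congrArg QuaternionAlgebra.imJ hβ
  have h3 := congrArg QuaternionAlgebra.imK hβ
  simp at h0 h1 h2 h3
  -- The imaginary coordinates of `β²` are `2 β.re` times those of `β`. A nonzero real part would
  -- make `β` a scalar and `e` a rational square.
  have hre : β.re = 0 := by
    by_contra h
    have h1' : β.imI = 0 := by
      have : 2 * β.re * β.imI = 0 := by linear_combination h1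
      simpa [h] using this
    have h2' : β.imJ = 0 := by
      have : 2 * β.re * β.imJ = 0 := by linear_combination h2
      simpa [h] using this
    have h3' : β.imK = 0 := by
      have : 2 * β.re * β.imK = 0 := by linear_combination h3
      simpa [h] using this
    rw [h1', h2', h3'] at h0
    exact he β.re (by linear_combination h0)
  refine ⟨hre, ?_⟩
  rw [hre] at h0
  linear_combination h0

/-- The image of `θ` is a pure quaternion of square `e`, hence of reduced norm `-e`. The answer
depends neither on `ι` nor on the algebra, which is why only the product of the `χᵢ` matters. -/
theorem redNorm_adelicEmbedding {a b : ℚ} (ι : K →ₐ[ℚ] ℍ[ℚ,a,b]) {e : ℤ}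
    (he : ∀ r : ℚ, r * r ≠ e) {θ : K} (hθ : θ * θ = e) (x y : Adeles) :
    redNorm (algebraMap ℚ Adeles a) (algebraMap ℚ Adeles b)
      (adelicEmbedding ι (x ⊗ₜ[ℚ] (1 : K) + y ⊗ₜ[ℚ] θ)) = x ^ 2 - e * y ^ 2 := by
  obtain ⟨h0, h1⟩ := pure_of_mul_self he (β := ι θ) (by rw [← map_mul, hθ, map_intCast])
  have h1' := congrArg (algebraMap ℚ Adeles) h1
  simp only [map_add, map_sub, map_mul, map_pow, map_intCast] at h1'
  have hz : adelicEmbedding ι (x ⊗ₜ[ℚ] (1 : K) + y ⊗ₜ[ℚ] θ) =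
      ⟨x, y * algebraMap ℚ Adeles (ι θ).imI, y * algebraMap ℚ Adeles (ι θ).imJ,
        y * algebraMap ℚ Adeles (ι θ).imK⟩ := by
    rw [map_add, adelicEmbedding, Algebra.TensorProduct.lift_tmul,
      Algebra.TensorProduct.lift_tmul, map_one, mul_one]
    have hx : Algebra.ofId Adeles (AdelicQuaternion a b) x = ⟨x, 0, 0, 0⟩ := by
      rw [Algebra.ofId_apply, QuaternionAlgebra.algebraMap_eq]
    have hy : Algebra.ofId Adeles (AdelicQuaternion a b) y = ⟨y, 0, 0, 0⟩ := by
      rw [Algebra.ofId_apply, QuaternionAlgebra.algebraMap_eq]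
    have hi : ((rationalToAdelic a b).comp ι) θ = ⟨0, algebraMap ℚ Adeles (ι θ).imI,
        algebraMap ℚ Adeles (ι θ).imJ, algebraMap ℚ Adeles (ι θ).imK⟩ := by
      change (⟨algebraMap ℚ Adeles (ι θ).re, _, _, _⟩ : AdelicQuaternion a b) = _
      rw [h0, map_zero]
      rfl
    rw [hx, hy, hi]
    ext <;> simp
  rw [hz]
  change x ^ 2 - _ * (y * _) ^ 2 - _ * (y * _) ^ 2 + _ * _ * (y * _) ^ 2 = _
  linear_combination (-y ^ 2) * h1'

theorem exists_tmul_eq (hK : Module.finrank ℚ K = 2) {θ : K}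
    (hθ : ∀ r : ℚ, θ ≠ algebraMap ℚ K r) (t : Adeles ⊗[ℚ] K) :
    ∃ x y : Adeles, t = x ⊗ₜ[ℚ] (1 : K) + y ⊗ₜ[ℚ] θ := by
  induction t with
  | zero => exact ⟨0, 0, by simp⟩
  | add t₁ t₂ h₁ h₂ =>
    obtain ⟨x₁, y₁, rfl⟩ := h₁
    obtain ⟨x₂, y₂, rfl⟩ := h₂
    refine ⟨x₁ + x₂, y₁ + y₂, ?_⟩
    rw [TensorProduct.add_tmul, TensorProduct.add_tmul]
    abel
  | tmul x z =>
    obtain ⟨r, s, rfl⟩ := exists_eq_add_mul hK hθ z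
    refine ⟨r • x, s • x, ?_⟩
    rw [TensorProduct.smul_tmul, TensorProduct.smul_tmul, ← TensorProduct.tmul_add,
      Algebra.smul_def, Algebra.smul_def, mul_one]

/-- The conjugate `x - yθ` multiplies the element to the unit scalar `u`. -/
theorem exists_units_tmul {e : ℤ} {θ : K} (hθ : θ * θ = e) {u : Adelesˣ} {x y : Adeles}
    (hu : (u : Adeles) = x ^ 2 - e * y ^ 2) :
    ∃ t : (Adeles ⊗[ℚ] K)ˣ, (t : Adeles ⊗[ℚ] K) = x ⊗ₜ[ℚ] (1 : K) + y ⊗ₜ[ℚ] θ := by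
  have h : IsUnit (x ⊗ₜ[ℚ] (1 : K) + y ⊗ₜ[ℚ] θ) := by
    refine isUnit_of_mul_isUnit_left (y := x ⊗ₜ[ℚ] (1 : K) - y ⊗ₜ[ℚ] θ) ?_
    have : (x ⊗ₜ[ℚ] (1 : K) + y ⊗ₜ[ℚ] θ) * (x ⊗ₜ[ℚ] (1 : K) - y ⊗ₜ[ℚ] θ) =
        algebraMap Adeles (Adeles ⊗[ℚ] K) u := by
      have he : (y * y) ⊗ₜ[ℚ] (e : K) = (e * (y * y) : Adeles) ⊗ₜ[ℚ] (1 : K) := by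
        rw [← zsmul_one e, TensorProduct.tmul_smul, TensorProduct.smul_tmul', zsmul_eq_mul]
      rw [mul_sub, add_mul, add_mul]
      simp only [Algebra.TensorProduct.tmul_mul_tmul, one_mul, mul_one, hθ, he]
      rw [Algebra.TensorProduct.algebraMap_apply, Algebra.algebraMap_self_apply, hu,
        TensorProduct.sub_tmul, mul_comm y x, sq, sq]
      abel
    rw [this]
    exact u.isUnit.map _
  exact ⟨h.unit, rfl⟩

end TorusCharacter

namespace TorusCharacter

open IsDedekindDomain Topology
open scoped NumberTheorySymbols

/-! ### Topology of the adelic groups -/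

section topology

variable (a b : ℚ)

theorem continuous_adelicQuaternion_iff {X : Type*} [TopologicalSpace X]
    {f : X → AdelicQuaternion a b} :
    Continuous f ↔ Continuous (fun x => (f x).re) ∧ Continuous (fun x => (f x).imI) ∧
      Continuous (fun x => (f x).imJ) ∧ Continuous (fun x => (f x).imK) := by
  rw [continuous_induced_rng, continuous_pi_iff, Fin.forall_fin_succ, Fin.forall_fin_succ,
    Fin.forall_fin_succ, Fin.forall_fin_one]
  rfl

theorem continuous_components :
    Continuous (fun x : AdelicQuaternion a b => x.re) ∧
    Continuous (fun x : AdelicQuaternion a b => x.imI) ∧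
    Continuous (fun x : AdelicQuaternion a b => x.imJ) ∧
    Continuous (fun x : AdelicQuaternion a b => x.imK) :=
  (continuous_adelicQuaternion_iff a b).mp continuous_id

/-- This makes the adelic unit groups, and then the torus quotient, topological groups, as the
translation argument for Haar measure requires. -/
instance : ContinuousMul (AdelicQuaternion a b) where
  continuous_mul := by
    obtain ⟨h0, h1, h2, h3⟩ := continuous_components a b
    have f0 := h0.comp (continuous_fst (X := AdelicQuaternion a b) (Y := AdelicQuaternion a b))
    have f1 := h1.comp (continuous_fst (X := AdelicQuaternion a b) (Y := AdelicQuaternion a b))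
    have f2 := h2.comp (continuous_fst (X := AdelicQuaternion a b) (Y := AdelicQuaternion a b))
    have f3 := h3.comp (continuous_fst (X := AdelicQuaternion a b) (Y := AdelicQuaternion a b))
    have g0 := h0.comp (continuous_snd (X := AdelicQuaternion a b) (Y := AdelicQuaternion a b))
    have g1 := h1.comp (continuous_snd (X := AdelicQuaternion a b) (Y := AdelicQuaternion a b))
    have g2 := h2.comp (continuous_snd (X := AdelicQuaternion a b) (Y := AdelicQuaternion a b))
    have g3 := h3.comp (continuous_snd (X := AdelicQuaternion a b) (Y := AdelicQuaternion a b))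
    simp only [Function.comp_def] at f0 f1 f2 f3 g0 g1 g2 g3
    rw [continuous_adelicQuaternion_iff]
    simp only [QuaternionAlgebra.re_mul, QuaternionAlgebra.imI_mul, QuaternionAlgebra.imJ_mul,
      QuaternionAlgebra.imK_mul]
    refine ⟨?_, ?_, ?_, ?_⟩ <;> fun_prop

theorem continuous_redNorm : Continuous (redNorm (algebraMap ℚ Adeles a) (algebraMap ℚ Adeles b)) := by
  obtain ⟨h0, h1, h2, h3⟩ := continuous_components a b
  change Continuous fun x : AdelicQuaternion a b => x.re ^ 2 - algebraMap ℚ Adeles a * x.imI ^ 2 -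
    algebraMap ℚ Adeles b * x.imJ ^ 2 +
      algebraMap ℚ Adeles a * algebraMap ℚ Adeles b * x.imK ^ 2
  fun_prop

theorem continuous_compNorm (ψ : Adelesˣ →ₜ* ℤˣ) : Continuous (compNorm a b ψ) :=
  Continuous.quotient_lift (ψ.continuous_toFun.comp
    (Continuous.units_map _ (continuous_redNorm a b))) _

end topology

variable {s : ℕ} {a b : Fin (s + 1) → ℚ} {K : Type*} [Field K] [NumberField K]

theorem prodCompNorm_apply (χ : Fin (s + 1) → quadraticHeckeCharacters) (g : AdelicG a b) :
    prodCompNorm a b χ g = ∏ i, compNorm (a i) (b i) (χ i) (g i) := by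
  rw [prodCompNorm, MonoidHom.finsetProd_apply]
  rfl

theorem continuous_prodCompNorm (χ : Fin (s + 1) → quadraticHeckeCharacters) :
    Continuous (prodCompNorm a b χ) := by
  have : (prodCompNorm a b χ : AdelicG a b → ℤˣ) =
      fun g => ∏ i, compNorm (a i) (b i) (χ i) (g i) := funext (prodCompNorm_apply χ)
  rw [this]
  exact continuous_finsetProd _ fun i _ =>
    (continuous_compNorm (a i) (b i) (χ i)).comp (continuous_apply i)

instance (ι : ∀ i, K →ₐ[ℚ] ℍ[ℚ,a i,b i]) : IsTopologicalGroup (TorusQuotient ι) :=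
  inferInstanceAs (IsTopologicalGroup (adelicTorus ι ⧸ rationalTorus ι))

/-- The character of `[T_ι]` associated with a tuple of Hecke characters, with values in `{±1}`. -/
noncomputable def torusSign (ι : ∀ i, K →ₐ[ℚ] ℍ[ℚ,a i,b i])
    (χ : Fin (s + 1) → quadraticHeckeCharacters) : TorusQuotient ι →* ℤˣ :=
  (tupleCharacter a b χ).comp (torusToGChar ι)

theorem torusCharacter_eq (ι : ∀ i, K →ₐ[ℚ] ℍ[ℚ,a i,b i])
    (χ : Fin (s + 1) → quadraticHeckeCharacters) :
    torusCharacter ι χ = fun t => (((torusSign ι χ t : ℤˣ) : ℤ) : ℂ) := rfl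

theorem continuous_torusSign (ι : ∀ i, K →ₐ[ℚ] ℍ[ℚ,a i,b i])
    (χ : Fin (s + 1) → quadraticHeckeCharacters) : Continuous (torusSign ι χ) :=
  (QuotientGroup.isQuotientMap_mk (N := rationalTorus ι)).continuous_iff.mpr
    ((continuous_prodCompNorm χ).comp continuous_subtype_val)

/-- The class in `[T_ι]` of an idele of `K`. -/
noncomputable def torusClass (ι : ∀ i, K →ₐ[ℚ] ℍ[ℚ,a i,b i]) :
    (Adeles ⊗[ℚ] K)ˣ →* TorusQuotient ι :=
  (QuotientGroup.mk' (rationalTorus ι)).comp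
    ((torusMap ι).rangeRestrict.comp (QuotientGroup.mk' _))

theorem torusClass_surjective (ι : ∀ i, K →ₐ[ℚ] ℍ[ℚ,a i,b i]) :
    Function.Surjective (torusClass ι) :=
  (QuotientGroup.mk'_surjective _).comp
    ((torusMap ι).rangeRestrict_surjective.comp (QuotientGroup.mk'_surjective _))

theorem torusSign_torusClass (ι : ∀ i, K →ₐ[ℚ] ℍ[ℚ,a i,b i])
    (χ : Fin (s + 1) → quadraticHeckeCharacters) (t : (Adeles ⊗[ℚ] K)ˣ) :
    torusSign ι χ (torusClass ι t) = ∏ i, (χ i : Adelesˣ →ₜ* ℤˣ)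
      (ideleNorm (a i) (b i) (Units.map (adelicEmbedding (ι i) : Adeles ⊗[ℚ] K →* _) t)) :=
  prodCompNorm_apply χ _

theorem coe_prod_apply (χ : Fin (s + 1) → quadraticHeckeCharacters) (u : Adelesˣ) :
    ((∏ i, χ i : quadraticHeckeCharacters) : Adelesˣ →ₜ* ℤˣ) u =
      ∏ i, (χ i : Adelesˣ →ₜ* ℤˣ) u := by
  let ev : (Adelesˣ →ₜ* ℤˣ) →* ℤˣ :=
    { toFun := fun ψ => ψ u, map_one' := rfl, map_mul' := fun _ _ => rfl }
  exact map_prod (ev.comp quadraticHeckeCharacters.subtype) χ Finset.univ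

/-- The character of `[T_ι]` is given by the product of the Hecke characters evaluated at the
norm form. -/
theorem torusSign_eq_of_norm (ι : ∀ i, K →ₐ[ℚ] ℍ[ℚ,a i,b i])
    (χ : Fin (s + 1) → quadraticHeckeCharacters) {e : ℤ} (he : ∀ r : ℚ, r * r ≠ e) {θ : K}
    (hθ : θ * θ = e) {t : (Adeles ⊗[ℚ] K)ˣ} {x y : Adeles}
    (ht : (t : Adeles ⊗[ℚ] K) = x ⊗ₜ[ℚ] (1 : K) + y ⊗ₜ[ℚ] θ) :
    ∃ u : Adelesˣ, (u : Adeles) = x ^ 2 - e * y ^ 2 ∧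
      torusSign ι χ (torusClass ι t) = (∏ i, χ i).1 u := by
  have hval : ∀ i, (ideleNorm (a i) (b i)
      (Units.map (adelicEmbedding (ι i) : Adeles ⊗[ℚ] K →* _) t) : Adeles) = x ^ 2 - e * y ^ 2 := by
    intro i
    rw [← redNorm_adelicEmbedding (ι i) he hθ, ← ht]
    rfl
  -- All factors have the same norm; index `0`, which always exists, supplies the common idele.
  refine ⟨_, hval 0, ?_⟩
  rw [torusSign_torusClass, coe_prod_apply]
  exact Finset.prod_congr rfl fun i _ => congrArg _ (Units.ext ((hval i).trans (hval 0).symm))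

/-! ### Integrals of signs -/

section integral

variable {G : Type*} [Group G] [MeasurableSpace G] (μ : Measure G)

theorem integrable_sign [TopologicalSpace G] [BorelSpace G] [IsProbabilityMeasure μ] {F : G →* ℤˣ} (hF : Continuous F) :
    Integrable (fun t => (((F t : ℤˣ) : ℤ) : ℂ)) μ := by
  have hc : Continuous fun t => (((F t : ℤˣ) : ℤ) : ℂ) :=
    (continuous_of_discreteTopology (f := fun u : ℤˣ => (((u : ℤˣ) : ℤ) : ℂ))).comp hF
  refine (integrable_const (1 : ℝ)).mono' hc.measurable.aestronglyMeasurable ?_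
  refine Filter.Eventually.of_forall fun t => ?_
  rcases Int.units_eq_one_or (F t) with h | h <;> simp [h]

theorem integral_sign_of_forall [IsProbabilityMeasure μ] {F : G →* ℤˣ} (hF : ∀ t, F t = 1) :
    ∫ t, (((F t : ℤˣ) : ℤ) : ℂ) ∂μ = 1 := by
  simp [hF]

/-- Orthogonality of characters: translation by `g` preserves the integral and also changes its
sign. -/
theorem integral_sign_of_exists [TopologicalSpace G] [IsTopologicalGroup G] [BorelSpace G]
    [μ.IsHaarMeasure] {F : G →* ℤˣ} {g : G} (hg : F g = -1) :
    ∫ t, (((F t : ℤˣ) : ℤ) : ℂ) ∂μ = 0 := by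
  have h := integral_mul_left_eq_self (μ := μ) (fun t => (((F t : ℤˣ) : ℤ) : ℂ)) g
  simp only [map_mul, hg, neg_mul, one_mul, Units.val_neg, Int.cast_neg, integral_neg] at h
  exact self_eq_neg.mp h.symm

end integral

/-! ### Local norms with value `-1` -/

/-- At a prime that is inert for `d` and split for `e` there is a value of the norm form of
`ℚ(√e)` on which a character with Legendre values `(d / ·)` is nontrivial. -/
theorem exists_norm_apply_eq_neg_one {ψ : Adelesˣ →ₜ* ℤˣ} {d : ℤ}
    (hψ : CorrespondsToLegendreSymbol ψ d) {e : ℤ} (he : Squarefree e) (hde : d ≠ e) :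
    ∃ (u : Adelesˣ) (x y : Adeles), (u : Adeles) = x ^ 2 - e * y ^ 2 ∧ ψ u = -1 := by
  obtain ⟨p, hp, hpp, hpo, hpd, hpe⟩ := exists_prime_legendreSym hψ.1 hψ.2.1 he hde
    (2 * d.natAbs)
  have := Fact.mk hpp
  have hbig : ¬ p ∣ 2 * d.natAbs := Nat.not_dvd_of_pos_of_lt (Nat.pos_of_ne_zero
    (mul_ne_zero two_ne_zero (Int.natAbs_ne_zero.mpr hψ.1.ne_zero))) hp
  obtain ⟨hunr, hval⟩ := hψ.hasLegendreValues p hbig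
  rw [jacobiSym.legendreSym.to_jacobiSym, hpd] at hval
  have hprime : Prime (p : ℤ) := Nat.prime_iff_prime_int.mp hpp
  -- A root `c` of `X² = e` modulo `p` is used as it stands or, if `p²` divides `c² - e`, shifted by
  -- `p`: the derivative `2c` is a unit modulo `p`, so the valuation becomes exactly one.
  obtain ⟨X, hX1, hX2⟩ : ∃ X : ℤ, (p : ℤ) ∣ X ^ 2 - e ∧ ¬ (p : ℤ) ^ 2 ∣ X ^ 2 - e := by
    rw [← jacobiSym.legendreSym.to_jacobiSym] at hpe
    have he0 : (e : ZMod p) ≠ 0 := fun h => by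
      rw [(legendreSym.eq_zero_iff p e).mpr h] at hpe
      exact zero_ne_one hpe
    obtain ⟨c, hc⟩ := (legendreSym.eq_one_iff p he0).mp hpe
    obtain ⟨c, rfl⟩ := ZMod.intCast_surjective c
    have hdvd : (p : ℤ) ∣ c ^ 2 - e := by
      rw [sq]
      refine (ZMod.intCast_eq_intCast_iff_dvd_sub _ _ _).mp ?_
      rw [hc, Int.cast_mul]
    by_cases h2 : (p : ℤ) ^ 2 ∣ c ^ 2 - e
    · refine ⟨c + p, ?_, fun h => ?_⟩
      · have h : (c + p) ^ 2 - e = (c ^ 2 - e) + p * (2 * c + p) := by ring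
        rw [h]
        exact dvd_add hdvd (dvd_mul_right _ _)
      · have h' : (p : ℤ) ^ 2 ∣ p * (2 * c) := by
          have h3 : (p : ℤ) * (2 * c) = ((c + p) ^ 2 - e) - (c ^ 2 - e) - p ^ 2 := by ring
          rw [h3]
          exact dvd_sub (dvd_sub h h2) dvd_rfl
        rw [sq, mul_dvd_mul_iff_left hprime.ne_zero] at h'
        rcases hprime.dvd_or_dvd h' with h4 | h4
        · have h5 : p ∣ 2 := by exact_mod_cast h4
          rw [(Nat.prime_dvd_prime_iff_eq hpp Nat.prime_two).mp h5] at hpo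
          exact absurd hpo (by decide)
        · refine he0 ?_
          rw [hc, (ZMod.intCast_zmod_eq_zero_iff_dvd c p).mpr h4, mul_zero]
    · exact ⟨c, hdvd, h2⟩
  obtain ⟨m, hm⟩ := hX1
  have hpm : ¬ (p : ℤ) ∣ m := fun h => hX2 (by rw [hm, sq]; exact mul_dvd_mul_left _ h)
  have hm1 : Valued.v (m : (placeOfPrime p).adicCompletion ℚ) = 1 :=
    (valued_intCast_eq_one_iff p m).mpr hpm
  have hm0 : (m : (placeOfPrime p).adicCompletion ℚ) ≠ 0 := fun h => by simp [h] at hm1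
  set z : ((placeOfPrime p).adicCompletion ℚ)ˣ := primeUniformizer p * Units.mk0 _ hm0 with hz
  have hzX : (z : (placeOfPrime p).adicCompletion ℚ) = X ^ 2 - e := by
    rw [hz, Units.val_mul, coe_primeUniformizer, Units.val_mk0]
    have h := congrArg (Int.cast : ℤ → (placeOfPrime p).adicCompletion ℚ) hm
    push_cast at h
    exact h.symm
  -- the idempotent of the adele ring at the place `p`
  set ε : Adeles := localIdele (placeOfPrime p) (Units.mk0 2 (by
    exact_mod_cast natCast_adicCompletion_ne_zero (placeOfPrime p) two_ne_zero)) - 1 with hε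
  have hε0 : realComponent ε = 0 := by rw [hε, map_sub, realComponent_localIdele, map_one, sub_self]
  have hε1 : finiteComponent (placeOfPrime p) ε = 1 := by
    rw [hε, map_sub, finiteComponent_localIdele_same, map_one, Units.val_mk0]
    norm_num
  have hε2 : ∀ w ≠ placeOfPrime p, finiteComponent w ε = 0 := fun w hw => by
    rw [hε, map_sub, finiteComponent_localIdele_of_ne hw, map_one, sub_self]
  -- The pair `(x, y)` is `(X, 1)` at `p` and `(1, 0)` at every other place, so the norm form is `X²
  -- - e` at `p` and `1` elsewhere.
  refine ⟨localIdele (placeOfPrime p) z, 1 + (X - 1) * ε, ε, adele_ext ?_ fun w => ?_, ?_⟩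
  · simp [hε0]
  · by_cases hw : w = placeOfPrime p
    · subst hw
      rw [finiteComponent_localIdele_same, hzX]
      simp [hε1]
    · rw [finiteComponent_localIdele_of_ne hw]
      simp [hε2 w hw]
  · change localCharacter ψ (placeOfPrime p) z = -1
    rw [hz, map_mul, hunr (Units.mk0 _ hm0) hm1, mul_one]
    exact Units.ext hval

end TorusCharacter

theorem mainTheorem7 (s : ℕ) (a b : Fin (s + 1) → ℚ) (ha : ∀ i, a i ≠ 0) (hb : ∀ i, b i ≠ 0)
    (χ : Fin (s + 1) → TorusCharacter.quadraticHeckeCharacters) :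
    (∏ i, χ i = 1 →
      ∀ (K : Type*) [Field K] [NumberField K], Module.finrank ℚ K = 2 →
      ∀ (ι : ∀ i, K →ₐ[ℚ] ℍ[ℚ,a i,b i]) (μ : Measure (TorusCharacter.TorusQuotient ι))
        [μ.IsHaarMeasure] [IsProbabilityMeasure μ],
        Integrable (TorusCharacter.torusCharacter ι χ) μ ∧
          ∫ t, TorusCharacter.torusCharacter ι χ t ∂μ = 1) ∧
    (∏ i, χ i ≠ 1 →
      (∃! d : ℤ, TorusCharacter.CorrespondsToLegendreSymbol (∏ i, χ i).1 d) ∧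
      ∀ d : ℤ, TorusCharacter.CorrespondsToLegendreSymbol (∏ i, χ i).1 d →
      ∀ (K : Type*) [Field K] [NumberField K], Module.finrank ℚ K = 2 →
      ∀ (ι : ∀ i, K →ₐ[ℚ] ℍ[ℚ,a i,b i]) (μ : Measure (TorusCharacter.TorusQuotient ι))
        [μ.IsHaarMeasure] [IsProbabilityMeasure μ],
        Integrable (TorusCharacter.torusCharacter ι χ) μ ∧
        (IsEmpty (K ≃ₐ[ℚ] QuadraticAlgebra ℚ (d : ℚ) 0) →
          ∫ t, TorusCharacter.torusCharacter ι χ t ∂μ = 0) ∧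
        (Nonempty (K ≃ₐ[ℚ] QuadraticAlgebra ℚ (d : ℚ) 0) →
          ∫ t, TorusCharacter.torusCharacter ι χ t ∂μ = 1)) := by
  open TorusCharacter in
  refine ⟨fun hχ K _ _ hK ι μ _ _ => ⟨?_, ?_⟩,
    fun hχ => ⟨existsUnique_correspondsToLegendreSymbol (∏ i, χ i).2
      fun h => hχ (Subtype.ext h), fun d hd K _ _ hK ι μ _ _ =>
      ⟨?_, fun hempty => ?_, fun ⟨f⟩ => ?_⟩⟩⟩
  · rw [torusCharacter_eq]
    exact integrable_sign μ (continuous_torusSign ι χ)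
  · rw [torusCharacter_eq]
    refine integral_sign_of_forall μ (F := torusSign ι χ) fun t => ?_
    obtain ⟨t, rfl⟩ := torusClass_surjective ι t
    obtain ⟨e, θ, he, he1, hθ⟩ := exists_squarefree_sqrt hK
    obtain ⟨x, y, ht⟩ := exists_tmul_eq hK (ne_algebraMap_of_mul_self he he1 hθ) t
    obtain ⟨u, -, hu⟩ := torusSign_eq_of_norm ι χ (not_isSquare_of_squarefree he he1) hθ ht
    rw [hu, hχ]
    rfl
  · rw [torusCharacter_eq]
    exact integrable_sign μ (continuous_torusSign ι χ)
  · rw [torusCharacter_eq]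
    obtain ⟨e, θ, he, he1, hθ⟩ := exists_squarefree_sqrt hK
    -- Equality would identify `K` with `ℚ(√d)`, which this case excludes.
    have hde : d ≠ e := by
      rintro rfl
      exact not_isEmpty_iff.mpr (nonempty_algEquiv_quadraticAlgebra hK he he1 hθ) hempty
    obtain ⟨u, x, y, hu, hψ⟩ := exists_norm_apply_eq_neg_one hd he hde
    obtain ⟨t, ht⟩ := exists_units_tmul hθ hu
    obtain ⟨u', hu', htu⟩ := torusSign_eq_of_norm ι χ (not_isSquare_of_squarefree he he1) hθ ht
    refine integral_sign_of_exists μ (F := torusSign ι χ) (g := torusClass ι t) ?_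
    rw [htu, Units.ext (hu'.trans hu.symm), hψ]
  -- The isomorphism transports `√d` into `K`, so `e` may be taken to be `d` itself.
  · have hθ : f.symm ⟨0, 1⟩ * f.symm ⟨0, 1⟩ = (d : K) := by
      have h : (⟨0, 1⟩ * ⟨0, 1⟩ : QuadraticAlgebra ℚ (d : ℚ) 0) = (d : ℤ) := by
        ext <;> simp
      rw [← map_mul, h, map_intCast]
    rw [torusCharacter_eq]
    refine integral_sign_of_forall μ (F := torusSign ι χ) fun t => ?_
    obtain ⟨t, rfl⟩ := torusClass_surjective ι t
    obtain ⟨x, y, ht⟩ := exists_tmul_eq hK (ne_algebraMap_of_mul_self hd.1 hd.2.1 hθ) t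
    obtain ⟨u, hu, htu⟩ := torusSign_eq_of_norm ι χ (not_isSquare_of_squarefree hd.1 hd.2.1) hθ ht
    rw [htu]
    exact apply_eq_one_of_norm (∏ i, χ i).2
      (mul_ne_zero two_ne_zero (Int.natAbs_ne_zero.mpr hd.1.ne_zero)) hd.hasLegendreValues hu
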